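/- Let $K$ be a compact Hausdorff space and $C(K)$ the vector lattice of continuous real-valued functions on $K$ with the pointwise operations and order. Let $C(K)^\delta$ denote its Dedekind completion, that is, the (unique up to isomorphism) Dedekind complete vector lattice that contains $C(K)$ as a majorizing, order dense vector sublattice. A linear functional $\varphi$ on a vector lattice $E$ is *strictly positive* if $\varphi(f)>0$ for every $f>0$. An order bounded linear functional $\varphi$ on $E$ is *order continuous* if $\inf\{|\varphi(f)| : f\in D\}=0$ for every nonempty downward directed set $D\subseteq E$ with $\inf D=0$, and *$\sigma$-order continuous* if $\inf_{n}|\varphi(f_n)|=0$ for every decreasing sequence $(f_n)$ in $E$ with $\inf_n f_n=0$. A *category measure* on $K$ is a finite, positive, countably additive measure $\mu$ on the $\sigma$-algebra of subsets of $K$ with the property of Baire (the sets $U\mathbin{\Delta}N$ with $U$ open and $N$ meagre) such that, for every $A$ in this $\sigma$-algebra, $\mu(A)=0$ if and only if $A$ is meagre. For a collection $\mathcal F$ of nonempty sets and a finite sequence $\bar F=(F_1,\dots,F_n)$ in $\mathcal F$, let $i(\bar F)$ be the largest cardinality of a set $J\subseteq\{1,\dots,n\}$ with $\bigcap_{j\in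 J}F_j\neq\emptyset$, and let $k(\mathcal F)=\inf\{ i(\bar F)/n : n\geq 1,\ \bar F\in\mathcal F^n\}$ (with $k(\emptyset)=\infty$). The space $K$ satisfies *property (\*\*\*)* if the collection of all nonempty open subsets of $K$ can be written as a union of pairwise disjoint (possibly empty) collections $\mathcal T_n$, $n\in\mathbb N$, such that for every $n$: 1. $k(\mathcal T_n)>0$; 2. if $(U_m)$ is an increasing sequence of open sets with $\bigcup_m U_m\in\mathcal T_n$, then $U_{m_0}\in\mathcal T_n$ for some $m_0$; 3. if $U\in\mathcal T_n$ and $V$ is an open set such that $U\mathbin{\Delta}V$ is meagre, then $V\in\mathcal T_n$. Then the following statements are equivalent: - (i) $K$ satisfies property (\*\*\*); - (ii) $K$ admits a category measure; - (iii) $C(K)^\delta$ admits a strictly positive $\sigma$-order continuous linear functional; - (iv) $C(K)$ admits a strictly positive $\sigma$-order continuous linear functional; - (v) $C(K)$ admits a strictly positive order continuous linear functional; - (vi) $C(K)^\delta$ admits a strictly positive order continuous linear functional. -/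

import Mathlib

open Set

set_option linter.unusedSectionVars false
set_option linter.unusedVariables false

/-! ### Vector lattices

A real vector lattice is a real vector space with a lattice order for which addition is monotone
(`IsOrderedAddMonoid`) and multiplication by nonnegative scalars is monotone (`PosSMulMono ℝ`). -/

/-- A vector lattice is Archimedean if `inf {f / n : n ≥ 1} = 0` for every `f ≥ 0`. -/
class IsArchimedeanVectorLattice (X : Type*) [AddCommGroup X] [Lattice X] [Module ℝ X] : Prop where
  isGLB_inv_smul : ∀ f : X, 0 ≤ f → IsGLB (range fun n : ℕ => (1 / ((n : ℝ) + 1)) • f) 0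

instance ContinuousMap.isArchimedeanVectorLattice (K : Type*) [TopologicalSpace K] :
    IsArchimedeanVectorLattice C(K, ℝ) where
  isGLB_inv_smul f hf := by
    constructor
    · rintro _ ⟨n, rfl⟩
      exact smul_nonneg (by positivity) hf
    · intro g hg x
      have h1 : Filter.Tendsto (fun n : ℕ => (1 / ((n : ℝ) + 1)) * f x) Filter.atTop
          (nhds (0 * f x)) := tendsto_one_div_add_atTop_nhds_zero_nat.mul_const _
      rw [zero_mul] at h1
      refine ge_of_tendsto' h1 fun n => ?_
      have := hg ⟨n, rfl⟩
      simpa using this x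

/-- The inclusion `J : X → E` presents the vector lattice `E` as a Dedekind completion of the
vector lattice `X`: `E` is Dedekind complete, and `J` is an embedding of vector lattices whose
range is order dense and majorizing in `E`. -/
structure IsDedekindCompletion {X E : Type*} [AddCommGroup X] [Lattice X] [Module ℝ X]
    [AddCommGroup E] [Lattice E] [Module ℝ E] (J : X →ₗ[ℝ] E) : Prop where
  injective : Function.Injective J
  map_sup : ∀ x y, J (x ⊔ y) = J x ⊔ J y
  map_inf : ∀ x y, J (x ⊓ y) = J x ⊓ J y
  exists_isLUB : ∀ S : Set E, S.Nonempty → BddAbove S → ∃ a, IsLUB S a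
  exists_isGLB : ∀ S : Set E, S.Nonempty → BddBelow S → ∃ a, IsGLB S a
  orderDense : ∀ f : E, 0 < f → ∃ x : X, 0 < J x ∧ J x ≤ f
  majorizing : ∀ f : E, 0 ≤ f → ∃ x : X, f ≤ J x

/-! ### The Dedekind completion by cuts -/

/-- The Dedekind completion of an (Archimedean) vector lattice: the Dedekind cuts `(L, U)`
(`U` is the set of upper bounds of `L` and `L` the set of lower bounds of `U`) with `L` and `U`
nonempty, ordered by inclusion of `L`. -/
def DedekindCompletion (X : Type*) [Lattice X] : Type _ :=
  {A : DedekindCut X // A.left.Nonempty ∧ A.right.Nonempty}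

namespace DedekindCompletion

section Order

variable {X : Type*} [Lattice X]

/-- The lower set of a cut. -/
def L (A : DedekindCompletion X) : Set X := A.1.left

/-- The upper set of a cut. -/
def U (A : DedekindCompletion X) : Set X := A.1.right

theorem nonempty_L (A : DedekindCompletion X) : A.L.Nonempty := A.2.1

theorem nonempty_U (A : DedekindCompletion X) : A.U.Nonempty := A.2.2

theorem mem_U_iff {A : DedekindCompletion X} {x : X} : x ∈ A.U ↔ ∀ a ∈ A.L, a ≤ x := by
  unfold U L
  rw [← DedekindCut.upperBounds_left]
  rfl

theorem mem_L_iff {A : DedekindCompletion X} {x : X} : x ∈ A.L ↔ ∀ u ∈ A.U, x ≤ u := by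
  unfold U L
  rw [← DedekindCut.lowerBounds_right]
  rfl

theorem le_of_mem {A : DedekindCompletion X} {x y : X} (hx : x ∈ A.L) (hy : y ∈ A.U) : x ≤ y :=
  mem_U_iff.1 hy x hx

theorem ext_U {A B : DedekindCompletion X} (h : ∀ x, x ∈ A.U ↔ x ∈ B.U) : A = B :=
  Subtype.ext (DedekindCut.ext' (Set.ext h))

instance : Lattice (DedekindCompletion X) :=
  Subtype.lattice
    (fun {A B} hA hB => by
      obtain ⟨a, ha⟩ := hA.1
      obtain ⟨u, hu⟩ := hA.2
      obtain ⟨v, hv⟩ := hB.2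
      refine ⟨⟨a, (le_sup_left : A ≤ A ⊔ B) ha⟩, u ⊔ v, ?_⟩
      rw [← DedekindCut.le_principal_iff] at hu hv ⊢
      exact sup_le (hu.trans (DedekindCut.principal_le_principal.2 le_sup_left))
        (hv.trans (DedekindCut.principal_le_principal.2 le_sup_right)))
    (fun {A B} hA hB => by
      obtain ⟨a, ha⟩ := hA.1
      obtain ⟨b, hb⟩ := hB.1
      obtain ⟨u, hu⟩ := hA.2
      refine ⟨⟨a ⊓ b, ?_⟩, u, ?_⟩
      · rw [← DedekindCut.principal_le_iff] at ha hb ⊢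
        exact le_inf ((DedekindCut.principal_le_principal.2 inf_le_left).trans ha)
          ((DedekindCut.principal_le_principal.2 inf_le_right).trans hb)
      · rw [← DedekindCut.le_principal_iff] at hu ⊢
        exact inf_le_left.trans hu)

theorem le_iff_L {A B : DedekindCompletion X} : A ≤ B ↔ A.L ⊆ B.L := Iff.rfl

theorem le_iff_U {A B : DedekindCompletion X} : A ≤ B ↔ B.U ⊆ A.U :=
  ⟨fun h _ hx => mem_U_iff.2 fun a ha => mem_U_iff.1 hx a (h ha),
    fun h _ hx => mem_L_iff.2 fun u hu => mem_L_iff.1 hx u (h hu)⟩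

/-- The cut generated by a nonempty set that is bounded above, that is, its supremum. -/
def ofSet (S : Set X) (hS : S.Nonempty) (hS' : BddAbove S) : DedekindCompletion X :=
  ⟨⟨lowerBounds (upperBounds S), upperBounds S, by
      ext x
      exact ⟨fun h a ha => h fun u hu => hu ha, fun h a ha => ha h⟩, rfl⟩,
    ⟨hS.some, fun u hu => hu hS.some_mem⟩, hS'⟩

theorem mem_U_ofSet {S : Set X} {hS : S.Nonempty} {hS' : BddAbove S} {x : X} :
    x ∈ (ofSet S hS hS').U ↔ ∀ a ∈ S, a ≤ x := Iff.rfl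

theorem mem_L_ofSet {S : Set X} {hS : S.Nonempty} {hS' : BddAbove S} {x : X} (hx : x ∈ S) :
    x ∈ (ofSet S hS hS').L := fun _ hu => hu hx

/-- The canonical embedding, sending `x` to the cut `({y | y ≤ x}, {y | x ≤ y})`. -/
def of (x : X) : DedekindCompletion X :=
  ⟨DedekindCut.principal x, ⟨x, le_rfl⟩, ⟨x, le_rfl⟩⟩

theorem mem_L_of {x y : X} : y ∈ (of x).L ↔ y ≤ x := Iff.rfl

theorem mem_U_of {x y : X} : y ∈ (of x).U ↔ x ≤ y := Iff.rfl

theorem of_le_iff {x : X} {A : DedekindCompletion X} : of x ≤ A ↔ x ∈ A.L :=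
  ⟨fun h => h (le_refl x), fun h _ hy => mem_L_iff.2 fun u hu => le_trans hy (le_of_mem h hu)⟩

theorem le_of_iff {x : X} {A : DedekindCompletion X} : A ≤ of x ↔ x ∈ A.U :=
  ⟨fun h => mem_U_iff.2 fun _ ha => h ha, fun h _ hy => le_of_mem hy h⟩

theorem of_le_of {x y : X} : of x ≤ of y ↔ x ≤ y := of_le_iff

theorem of_injective : Function.Injective (of : X → DedekindCompletion X) := fun _ _ h =>
  le_antisymm (of_le_of.1 h.le) (of_le_of.1 h.ge)

theorem sup_mem_L {A : DedekindCompletion X} {x y : X} (hx : x ∈ A.L) (hy : y ∈ A.L) :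
    x ⊔ y ∈ A.L :=
  mem_L_iff.2 fun _ hu => sup_le (le_of_mem hx hu) (le_of_mem hy hu)

theorem of_sup (x y : X) : of (x ⊔ y) = of x ⊔ of y := by
  refine le_antisymm ?_ (sup_le (of_le_of.2 le_sup_left) (of_le_of.2 le_sup_right))
  exact of_le_iff.2 (sup_mem_L (of_le_iff.1 le_sup_left) (of_le_iff.1 le_sup_right))

theorem of_inf (x y : X) : of (x ⊓ y) = of x ⊓ of y := by
  refine le_antisymm (le_inf (of_le_of.2 inf_le_left) (of_le_of.2 inf_le_right)) ?_
  refine le_of_iff.2 (mem_U_iff.2 fun a ha => ?_)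
  have h := of_le_iff.2 ha
  exact le_inf (of_le_of.1 (h.trans inf_le_left)) (of_le_of.1 (h.trans inf_le_right))

theorem exists_isLUB (S : Set (DedekindCompletion X)) (hS : S.Nonempty) (hb : BddAbove S) :
    ∃ A, IsLUB S A := by
  obtain ⟨B, hB⟩ := hb
  obtain ⟨C, hC⟩ := hS
  obtain ⟨c, hc⟩ := C.nonempty_L
  obtain ⟨u, hu⟩ := B.nonempty_U
  refine ⟨ofSet (⋃ A ∈ S, A.L) ⟨c, mem_biUnion hC hc⟩ ⟨u, ?_⟩, ?_, ?_⟩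
  · intro x hx
    obtain ⟨A, hA, hxA⟩ := mem_iUnion₂.1 hx
    exact le_of_mem (le_iff_L.1 (hB hA) hxA) hu
  · intro A hA x hx
    exact mem_L_ofSet (mem_biUnion hA hx)
  · intro D hD
    refine le_iff_U.2 fun x hx => mem_U_ofSet.2 fun a ha => ?_
    obtain ⟨A, hA, haA⟩ := mem_iUnion₂.1 ha
    exact le_of_mem (le_iff_L.1 (hD hA) haA) hx

end Order

section Add

variable {X : Type*} [AddCommGroup X] [Lattice X] [IsOrderedAddMonoid X]

/-- `A + B` is the supremum of the sums `a + b` with `a` and `b` in the lower sets. -/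
instance : Add (DedekindCompletion X) where
  add A B := ofSet (Set.image2 (· + ·) A.L B.L) (A.nonempty_L.image2 B.nonempty_L) (by
    obtain ⟨u, hu⟩ := A.nonempty_U
    obtain ⟨v, hv⟩ := B.nonempty_U
    refine ⟨u + v, ?_⟩
    rintro _ ⟨a, ha, b, hb, rfl⟩
    exact add_le_add (le_of_mem ha hu) (le_of_mem hb hv))

theorem mem_U_add {A B : DedekindCompletion X} {x : X} :
    x ∈ (A + B).U ↔ ∀ a ∈ A.L, ∀ b ∈ B.L, a + b ≤ x :=
  mem_U_ofSet.trans Set.forall_mem_image2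

theorem add_mem_L {A B : DedekindCompletion X} {a b : X} (ha : a ∈ A.L) (hb : b ∈ B.L) :
    a + b ∈ (A + B).L := mem_L_ofSet ⟨a, ha, b, hb, rfl⟩

instance : Zero (DedekindCompletion X) := ⟨of 0⟩

/-- The negative of the cut `(L, U)` is the cut `(-U, -L)`. -/
instance : Neg (DedekindCompletion X) where
  neg A := ⟨⟨{x | -x ∈ A.U}, {x | -x ∈ A.L}, by
      ext x
      refine ⟨fun h => mem_L_iff.2 fun u hu => ?_, fun h a ha => ?_⟩
      · exact neg_le.1 (h (show - -u ∈ A.U by rwa [neg_neg]))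
      · exact neg_le_neg_iff.1 (le_of_mem h ha), by
      ext x
      refine ⟨fun h => mem_U_iff.2 fun u hu => ?_, fun h a ha => ?_⟩
      · exact le_neg.1 (h (show - -u ∈ A.L by rwa [neg_neg]))
      · exact neg_le_neg_iff.1 (le_of_mem ha h)⟩,
    ⟨-A.nonempty_U.some, by
      change - -A.nonempty_U.some ∈ A.U
      rw [neg_neg]
      exact A.nonempty_U.some_mem⟩,
    ⟨-A.nonempty_L.some, by
      change - -A.nonempty_L.some ∈ A.L
      rw [neg_neg]
      exact A.nonempty_L.some_mem⟩⟩

theorem mem_L_neg {A : DedekindCompletion X} {x : X} : x ∈ (-A).L ↔ -x ∈ A.U := Iff.rfl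

theorem mem_U_neg {A : DedekindCompletion X} {x : X} : x ∈ (-A).U ↔ -x ∈ A.L := Iff.rfl

theorem of_zero : of (0 : X) = 0 := rfl

theorem of_add (x y : X) : of (x + y) = of x + of y := by
  refine ext_U fun z => ?_
  rw [mem_U_add, mem_U_of]
  exact ⟨fun h a ha b hb => (add_le_add ha hb).trans h, fun h => h x le_rfl y le_rfl⟩

protected theorem add_comm' (A B : DedekindCompletion X) : A + B = B + A := by
  refine ext_U fun x => ?_
  rw [mem_U_add, mem_U_add]
  exact ⟨fun h a ha b hb => add_comm a b ▸ h b hb a ha, fun h a ha b hb => add_comm a b ▸ h b hb a ha⟩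

theorem mem_U_add_add {A B C : DedekindCompletion X} {x : X} :
    x ∈ (A + B + C).U ↔ ∀ a ∈ A.L, ∀ b ∈ B.L, ∀ c ∈ C.L, a + b + c ≤ x := by
  rw [mem_U_add]
  refine ⟨fun h a ha b hb c hc => h _ (add_mem_L ha hb) c hc, fun h d hd c hc => ?_⟩
  rw [← le_sub_iff_add_le]
  refine le_of_mem hd (mem_U_add.2 fun a ha b hb => ?_)
  rw [le_sub_iff_add_le]
  exact h a ha b hb c hc

protected theorem add_assoc' (A B C : DedekindCompletion X) : A + B + C = A + (B + C) := by
  refine ext_U fun x => ?_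
  rw [DedekindCompletion.add_comm' A (B + C), mem_U_add_add, mem_U_add_add]
  constructor
  · intro h b hb c hc a ha
    have := h a ha b hb c hc
    rwa [add_assoc, add_comm] at this
  · intro h a ha b hb c hc
    have := h b hb c hc a ha
    rwa [add_comm, ← add_assoc] at this

protected theorem zero_add' (A : DedekindCompletion X) : 0 + A = A := by
  refine ext_U fun x => ?_
  rw [mem_U_add, mem_U_iff]
  refine ⟨fun h a ha => by simpa using h 0 (le_refl (0 : X)) a ha, fun h z hz a ha => ?_⟩
  have hz : z ≤ 0 := hz
  exact (add_le_of_nonpos_left hz).trans (h a ha)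

end Add

section VectorLattice

variable {X : Type*} [AddCommGroup X] [Lattice X] [IsOrderedAddMonoid X] [Module ℝ X]
  [PosSMulMono ℝ X]

theorem nonpos_of_nsmul_le [IsArchimedeanVectorLattice X] {x y : X} (h : ∀ n : ℕ, n • x ≤ y) :
    x ≤ 0 := by
  have h0 : (0 : X) ≤ y := by simpa using h 0
  refine (IsArchimedeanVectorLattice.isGLB_inv_smul y h0).2 ?_
  rintro _ ⟨n, rfl⟩
  have hn : (0 : ℝ) < (n : ℝ) + 1 := by positivity
  have h1 := smul_le_smul_of_nonneg_left (h (n + 1)) (one_div_pos.2 hn).le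
  rw [← Nat.cast_smul_eq_nsmul ℝ, smul_smul] at h1
  push_cast at h1
  rwa [one_div_mul_cancel hn.ne', one_smul] at h1

protected theorem neg_add_cancel' [IsArchimedeanVectorLattice X] (A : DedekindCompletion X) :
    -A + A = 0 := by
  refine ext_U fun x => ?_
  rw [mem_U_add]
  constructor
  · intro h
    obtain ⟨u, hu⟩ := A.nonempty_U
    obtain ⟨a, ha⟩ := A.nonempty_L
    have key : ∀ n : ℕ, u + n • x ∈ A.U := by
      intro n
      induction n with
      | zero => simpa using hu
      | succ n ih =>
        refine mem_U_iff.2 fun b hb => ?_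
        have := h (-(u + n • x)) (mem_L_neg.2 (by rwa [neg_neg])) b hb
        rw [neg_add_le_iff_le_add] at this
        rwa [succ_nsmul, ← add_assoc]
    have : -x ≤ 0 := nonpos_of_nsmul_le (y := u - a) fun n => by
      have := le_of_mem ha (key n)
      rw [smul_neg, neg_le_sub_iff_le_add]
      exact this
    exact neg_nonpos.1 this
  · intro (h : 0 ≤ x) z hz a ha
    have : a ≤ -z := le_of_mem ha hz
    calc z + a ≤ z + -z := by gcongr
      _ = 0 := add_neg_cancel z
      _ ≤ x := h

instance [IsArchimedeanVectorLattice X] : AddCommGroup (DedekindCompletion X) where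
  add_assoc := DedekindCompletion.add_assoc'
  zero_add := DedekindCompletion.zero_add'
  add_zero A := by rw [DedekindCompletion.add_comm', DedekindCompletion.zero_add']
  add_comm := DedekindCompletion.add_comm'
  neg_add_cancel := DedekindCompletion.neg_add_cancel'
  nsmul := nsmulRec
  zsmul := zsmulRec

/-- For `c ≥ 0`, `c A` is the supremum of the elements `c a` with `a` in the lower set of `A`. -/
noncomputable def nnsmul (c : NNReal) (A : DedekindCompletion X) : DedekindCompletion X :=
  ofSet ((fun a => (c : ℝ) • a) '' A.L) (A.nonempty_L.image _) (by
    obtain ⟨u, hu⟩ := A.nonempty_U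
    refine ⟨(c : ℝ) • u, ?_⟩
    rintro _ ⟨a, ha, rfl⟩
    exact smul_le_smul_of_nonneg_left (le_of_mem ha hu) c.2)

theorem mem_U_nnsmul {c : NNReal} {A : DedekindCompletion X} {x : X} :
    x ∈ (nnsmul c A).U ↔ ∀ a ∈ A.L, (c : ℝ) • a ≤ x :=
  mem_U_ofSet.trans Set.forall_mem_image

theorem smul_mem_L_nnsmul {c : NNReal} {A : DedekindCompletion X} {a : X} (ha : a ∈ A.L) :
    (c : ℝ) • a ∈ (nnsmul c A).L := mem_L_ofSet ⟨a, ha, rfl⟩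

theorem le_inv_smul {c : NNReal} (hc : c ≠ 0) {x y : X} :
    (c : ℝ) • x ≤ y ↔ x ≤ ((c : ℝ)⁻¹) • y :=
  (le_inv_smul_iff_of_pos (NNReal.coe_pos.2 (pos_iff_ne_zero.2 hc))).symm

theorem zero_nnsmul (A : DedekindCompletion X) : nnsmul 0 A = 0 := by
  refine ext_U fun x => ?_
  rw [mem_U_nnsmul]
  obtain ⟨a, ha⟩ := A.nonempty_L
  refine ⟨fun h => ?_, fun h b _ => ?_⟩
  · have := h a ha
    rwa [NNReal.coe_zero, zero_smul] at this
  · rw [NNReal.coe_zero, zero_smul]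
    exact h

theorem one_nnsmul (A : DedekindCompletion X) : nnsmul 1 A = A := by
  refine ext_U fun x => ?_
  rw [mem_U_nnsmul, mem_U_iff]
  simp

theorem add_nnsmul (c d : NNReal) (A : DedekindCompletion X) :
    nnsmul (c + d) A = nnsmul c A + nnsmul d A := by
  refine ext_U fun x => ?_
  constructor
  · intro h
    rw [mem_U_nnsmul] at h
    refine mem_U_add.2 fun y hy z hz => ?_
    rw [← le_sub_iff_add_le]
    refine le_of_mem hy (mem_U_nnsmul.2 fun a ha => ?_)
    rw [le_sub_comm]
    refine le_of_mem hz (mem_U_nnsmul.2 fun b hb => ?_)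
    rw [le_sub_iff_add_le]
    refine le_trans ?_ (h _ (sup_mem_L ha hb))
    rw [NNReal.coe_add, add_smul, add_comm]
    exact add_le_add (smul_le_smul_of_nonneg_left le_sup_left c.2)
      (smul_le_smul_of_nonneg_left le_sup_right d.2)
  · intro h
    refine mem_U_nnsmul.2 fun a ha => ?_
    rw [NNReal.coe_add, add_smul]
    exact mem_U_add.1 h _ (smul_mem_L_nnsmul ha) _ (smul_mem_L_nnsmul ha)

theorem mul_nnsmul (c d : NNReal) (A : DedekindCompletion X) :
    nnsmul (c * d) A = nnsmul c (nnsmul d A) := by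
  rcases eq_or_ne c 0 with rfl | hc
  · rw [zero_mul, zero_nnsmul, zero_nnsmul]
  refine ext_U fun x => ?_
  constructor
  · intro h
    refine mem_U_nnsmul.2 fun y hy => (le_inv_smul hc).2 ?_
    refine le_of_mem hy (mem_U_nnsmul.2 fun a ha => (le_inv_smul hc).1 ?_)
    rw [smul_smul]
    exact mem_U_nnsmul.1 h a ha
  · intro h
    refine mem_U_nnsmul.2 fun a ha => ?_
    rw [NNReal.coe_mul, mul_smul]
    exact mem_U_nnsmul.1 h _ (smul_mem_L_nnsmul ha)

theorem nnsmul_add (c : NNReal) (A B : DedekindCompletion X) :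
    nnsmul c (A + B) = nnsmul c A + nnsmul c B := by
  rcases eq_or_ne c 0 with rfl | hc
  · rw [zero_nnsmul, zero_nnsmul, zero_nnsmul, DedekindCompletion.zero_add']
  refine ext_U fun x => ?_
  constructor
  · intro h
    refine mem_U_add.2 fun y hy z hz => ?_
    rw [← le_sub_iff_add_le]
    refine le_of_mem hy (mem_U_nnsmul.2 fun a ha => ?_)
    rw [le_sub_comm]
    refine le_of_mem hz (mem_U_nnsmul.2 fun b hb => ?_)
    rw [le_sub_iff_add_le, ← smul_add, add_comm]
    exact mem_U_nnsmul.1 h _ (add_mem_L ha hb)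
  · intro h
    refine mem_U_nnsmul.2 fun y hy => (le_inv_smul hc).2 ?_
    refine le_of_mem hy (mem_U_add.2 fun a ha b hb => (le_inv_smul hc).1 ?_)
    rw [smul_add]
    exact mem_U_add.1 h _ (smul_mem_L_nnsmul ha) _ (smul_mem_L_nnsmul hb)

theorem nnsmul_of (c : NNReal) (x : X) : nnsmul c (of x) = of ((c : ℝ) • x) := by
  refine ext_U fun y => ?_
  rw [mem_U_nnsmul, mem_U_of]
  exact ⟨fun h => h x le_rfl, fun h a ha => (smul_le_smul_of_nonneg_left ha c.2).trans h⟩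

theorem nnsmul_le_nnsmul (c : NNReal) {A B : DedekindCompletion X} (h : A ≤ B) :
    nnsmul c A ≤ nnsmul c B :=
  le_iff_U.2 fun _ hx => mem_U_nnsmul.2 fun a ha => mem_U_nnsmul.1 hx a (h ha)

variable [IsArchimedeanVectorLattice X]

theorem nnsmul_sub (c : NNReal) (A B : DedekindCompletion X) :
    nnsmul c (A - B) = nnsmul c A - nnsmul c B := by
  rw [eq_sub_iff_add_eq, ← nnsmul_add, sub_add_cancel]

/-- For real `c`, `c A = c⁺ A - c⁻ A`. -/
noncomputable instance : SMul ℝ (DedekindCompletion X) where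
  smul c A := nnsmul c.toNNReal A - nnsmul (-c).toNNReal A

theorem smul_def (c : ℝ) (A : DedekindCompletion X) :
    c • A = nnsmul c.toNNReal A - nnsmul (-c).toNNReal A := rfl

theorem smul_eq_of_sub (p q : NNReal) (A : DedekindCompletion X) :
    ((p : ℝ) - q) • A = nnsmul p A - nnsmul q A := by
  rw [smul_def, sub_eq_sub_iff_add_eq_add, ← add_nnsmul, ← add_nnsmul]
  congr 1
  apply NNReal.coe_injective
  push_cast
  rw [Real.coe_toNNReal', Real.coe_toNNReal']
  have := max_zero_sub_max_neg_zero_eq_self ((p : ℝ) - q)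
  linarith

theorem smul_of_nonneg (c : NNReal) (A : DedekindCompletion X) : (c : ℝ) • A = nnsmul c A := by
  have := smul_eq_of_sub c 0 A
  rwa [NNReal.coe_zero, sub_zero, zero_nnsmul, sub_zero] at this

theorem exists_eq_sub (c : ℝ) : ∃ p q : NNReal, c = (p : ℝ) - q :=
  ⟨c.toNNReal, (-c).toNNReal, by
    rw [Real.coe_toNNReal', Real.coe_toNNReal', max_zero_sub_max_neg_zero_eq_self]⟩

noncomputable instance : Module ℝ (DedekindCompletion X) where
  one_smul A := by
    have := smul_of_nonneg 1 A
    rwa [NNReal.coe_one, one_nnsmul] at this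
  mul_smul c d A := by
    obtain ⟨p, q, rfl⟩ := exists_eq_sub c
    obtain ⟨r, s, rfl⟩ := exists_eq_sub d
    have h : ((p : ℝ) - q) * (r - s) = ((p * r + q * s : NNReal) : ℝ) - (p * s + q * r : NNReal) := by
      push_cast
      ring
    rw [h, smul_eq_of_sub, smul_eq_of_sub, smul_eq_of_sub]
    simp only [add_nnsmul, nnsmul_sub, mul_nnsmul]
    abel
  smul_zero c := by
    rw [smul_def, ← of_zero, nnsmul_of, nnsmul_of, smul_zero, smul_zero, sub_self]
    rfl
  smul_add c A B := by
    simp only [smul_def, nnsmul_add]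
    abel
  add_smul c d A := by
    obtain ⟨p, q, rfl⟩ := exists_eq_sub c
    obtain ⟨r, s, rfl⟩ := exists_eq_sub d
    have h : ((p : ℝ) - q) + (r - s) = ((p + r : NNReal) : ℝ) - (q + s : NNReal) := by
      push_cast
      ring
    rw [h, smul_eq_of_sub, smul_eq_of_sub, smul_eq_of_sub]
    simp only [add_nnsmul]
    abel
  zero_smul A := by
    have := smul_of_nonneg 0 A
    rwa [NNReal.coe_zero, zero_nnsmul] at this

instance : IsOrderedAddMonoid (DedekindCompletion X) where
  add_le_add_left A B h C := le_iff_U.2 fun _ hx =>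
    mem_U_add.2 fun a ha c hc => mem_U_add.1 hx a (h ha) c hc

instance : PosSMulMono ℝ (DedekindCompletion X) where
  smul_le_smul_of_nonneg_left c hc A B h := by
    lift c to NNReal using hc
    rw [smul_of_nonneg, smul_of_nonneg]
    exact nnsmul_le_nnsmul c h

variable (X) in
/-- The canonical embedding of a vector lattice into its Dedekind completion. -/
noncomputable def embedding : X →ₗ[ℝ] DedekindCompletion X where
  toFun := of
  map_add' := of_add
  map_smul' c x := by
    obtain ⟨p, q, rfl⟩ := exists_eq_sub c
    rw [RingHom.id_apply, smul_eq_of_sub, nnsmul_of, nnsmul_of, eq_sub_iff_add_eq, ← of_add,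
      sub_smul, sub_add_cancel]

/-- The vector lattice constructed above is a Dedekind completion. -/
theorem isDedekindCompletion_embedding : IsDedekindCompletion (embedding X) where
  injective := of_injective
  map_sup := of_sup
  map_inf := of_inf
  exists_isLUB := exists_isLUB
  exists_isGLB S hS hb := by
    obtain ⟨A, hA⟩ := exists_isLUB (lowerBounds S) hb (hS.mono fun a ha b hb => hb ha)
    exact ⟨A, isLUB_lowerBounds.1 hA⟩
  orderDense A hA := by
    have h0 : (0 : X) ∈ A.L := of_le_iff.1 hA.le
    obtain ⟨a, ha, ha'⟩ : ∃ a ∈ A.L, ¬ a ≤ 0 := by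
      by_contra! h
      exact hA.not_ge h
    refine ⟨a ⊔ 0, ?_, of_le_iff.2 (sup_mem_L ha h0)⟩
    refine lt_of_le_not_ge (of_le_of.2 le_sup_right) fun h => ha' ?_
    exact le_sup_left.trans (of_le_of.1 h)
  majorizing A _ := by
    obtain ⟨u, hu⟩ := A.nonempty_U
    exact ⟨u, le_of_iff.2 hu⟩

end VectorLattice

end DedekindCompletion

/-! ### Functionals on vector lattices -/

section Functionals

variable {E : Type*} [AddCommGroup E] [Lattice E] [Module ℝ E]

/-- A functional is order bounded if it maps order bounded sets to bounded sets. -/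
def IsOrderBoundedFunctional (φ : E →ₗ[ℝ] ℝ) : Prop :=
  ∀ a b : E, Bornology.IsBounded (φ '' Icc a b)

/-- `φ` is strictly positive if `φ f > 0` whenever `f > 0`. -/
def IsStrictlyPositiveFunctional (φ : E →ₗ[ℝ] ℝ) : Prop :=
  ∀ f : E, 0 < f → 0 < φ f

/-- `φ` is order bounded and `inf |φ (f n)| = 0` whenever `f n ↓ 0`. -/
def IsSigmaOrderContinuous (φ : E →ₗ[ℝ] ℝ) : Prop :=
  IsOrderBoundedFunctional φ ∧
    ∀ f : ℕ → E, Antitone f → IsGLB (range f) 0 → IsGLB (range fun n => |φ (f n)|) 0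

/-- `φ` is order bounded and `inf {|φ f| : f ∈ D} = 0` for every (nonempty) downward directed set
`D` with infimum `0`. -/
def IsOrderContinuous (φ : E →ₗ[ℝ] ℝ) : Prop :=
  IsOrderBoundedFunctional φ ∧
    ∀ D : Set E, D.Nonempty → DirectedOn (· ≥ ·) D → IsGLB D 0 →
      IsGLB ((fun f => |φ f|) '' D) 0

end Functionals

/-! ### Category measures and property (***) -/

section Category

/-- A category measure on `K`: a finite, countably additive, positive measure on the σ-algebra of
sets with the property of Baire (sets that differ from an open set by a meagre set, see
`BaireMeasurableSet.iff_residualEq_isOpen`) whose null sets are exactly the meagre sets. -/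
def IsCategoryMeasure {K : Type*} [TopologicalSpace K]
    (μ : @MeasureTheory.Measure K (eventuallyMeasurableSpace (borel K) (residual K))) : Prop :=
  μ univ < ⊤ ∧ ∀ A : Set K, BaireMeasurableSet A → (μ A = 0 ↔ IsMeagre A)

open Classical in
/-- For a finite sequence of sets `F₁, …, Fₙ`, the largest cardinality of a set of indices `J` with
`⋂ j ∈ J, F j` nonempty. -/
noncomputable def maxIntersecting {X : Type*} {n : ℕ} (F : Fin n → Set X) : ℕ :=
  (Finset.univ.filter fun J : Finset (Fin n) => (⋂ j ∈ J, F j).Nonempty).sup Finset.card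

/-- The Kelley intersection number of a collection of sets: the infimum of `i(F) / n` over all
`n ≥ 1` and all sequences `F` of length `n` in the collection. It takes values in `[0, ∞]`, so that
it is `∞` (in particular positive) for the empty collection. -/
noncomputable def kelleyNumber {X : Type*} (𝓕 : Set (Set X)) : ENNReal :=
  ⨅ (n : ℕ) (_ : 0 < n) (F : Fin n → Set X) (_ : ∀ j, F j ∈ 𝓕),
    (maxIntersecting F : ENNReal) / (n : ENNReal)

/-- Property (***): the nonempty open sets can be partitioned into collections `T 0, T 1, …` (some
of which may be empty) satisfying the three conditions below. -/
def PropertyTripleStar (K : Type*) [TopologicalSpace K] : Prop :=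
  ∃ T : ℕ → Set (Set K),
    (∀ m n, m ≠ n → Disjoint (T m) (T n)) ∧
    (⋃ n, T n) = {U : Set K | IsOpen U ∧ U.Nonempty} ∧
    ∀ n,
      0 < kelleyNumber (T n) ∧
      (∀ U : ℕ → Set K, (∀ m, IsOpen (U m)) → Monotone U → (⋃ m, U m) ∈ T n →
        ∃ m, U m ∈ T n) ∧
      (∀ U V : Set K, U ∈ T n → IsOpen V → IsMeagre (symmDiff U V) → V ∈ T n)

end Category

/-! ### Strictly positive functionals -/

section StrictlyPositive

variable {E : Type*} [AddCommGroup E] [Lattice E] [Module ℝ E]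

/-! Three mechanisms carry the equivalence.

Functionals. Under a strictly positive functional, a minimizing sequence in a set directed down to
zero already decreases to zero, so σ-order continuity and order continuity coincide
(`IsStrictlyPositiveFunctional.isOrderContinuous`). Order continuity makes the values of φ on the
lower and upper set of a cut meet, so φ extends to the Dedekind completion (`extendₗ`); restricting
back is possible because the embedding preserves infima.

Measures and functionals. Integration against a category measure is strictly positive because
nonempty open sets are not meagre, and σ-order continuous because functions decreasing to zero in
C(K) do so pointwise off a meagre set. Conversely, the Riesz measure of an order continuous
functional kills closed nowhere dense sets, since the continuous functions above such a set decrease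
to zero; hence it kills meagre sets and extends to the sets with the property of Baire
(`exists_isCategoryMeasure_of_isOrderContinuous`).

Measures and property (***). A category measure sorts the open sets by dyadic size, and a lower
bound on measure bounds the Kelley number from below. Conversely, Kelley's theorem, in the form of a
Riesz extension argument, gives each class a finitely additive measure that is bounded below on it
and vanishes on meagre sets (`exists_isMeagreNullContent`). Conditions 2 and 3 on the classes ensure
that passing to the generated outer measure loses none of this bound (`exists_measure`). A weighted
sum over the classes is a category measure. -/

theorem IsStrictlyPositiveFunctional.nonneg {φ : E →ₗ[ℝ] ℝ} (hφ : IsStrictlyPositiveFunctional φ)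
    {f : E} (hf : 0 ≤ f) : 0 ≤ φ f := by
  rcases hf.eq_or_lt with rfl | h
  · simp
  · exact (hφ f h).le

variable [IsOrderedAddMonoid E]

theorem IsStrictlyPositiveFunctional.monotone {φ : E →ₗ[ℝ] ℝ}
    (hφ : IsStrictlyPositiveFunctional φ) : Monotone φ := fun f g h => by
  have := hφ.nonneg (sub_nonneg.2 h)
  rw [map_sub] at this
  linarith

theorem Monotone.isOrderBoundedFunctional {φ : E →ₗ[ℝ] ℝ} (hφ : Monotone φ) :
    IsOrderBoundedFunctional φ := fun a b =>
  (Metric.isBounded_Icc (φ a) (φ b)).subset (by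
    rintro _ ⟨x, hx, rfl⟩
    exact ⟨hφ hx.1, hφ hx.2⟩)

theorem isGLB_abs_zero_iff {S : Set ℝ} (hS : ∀ x ∈ S, 0 ≤ x) :
    IsGLB S 0 ↔ ∀ ε > 0, ∃ x ∈ S, x < ε := by
  constructor
  · intro h ε hε
    by_contra! hc
    exact absurd (h.2 hc) (not_le.2 hε)
  · refine fun h => ⟨hS, fun b hb => ?_⟩
    by_contra! hc
    obtain ⟨x, hx, hxb⟩ := h b hc
    exact absurd (hb hx) (not_le.2 hxb)

/-- Positivity makes order boundedness automatic and the absolute values superfluous. -/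
theorem isSigmaOrderContinuous_iff {φ : E →ₗ[ℝ] ℝ} (hφ : IsStrictlyPositiveFunctional φ) :
    IsSigmaOrderContinuous φ ↔ ∀ f : ℕ → E, Antitone f → IsGLB (range f) 0 →
      ∀ ε > 0, ∃ n, φ (f n) < ε := by
  have key : ∀ f : ℕ → E, IsGLB (range f) 0 → (IsGLB (range fun n => |φ (f n)|) 0 ↔
      ∀ ε > 0, ∃ n, φ (f n) < ε) := fun f h => by
    rw [isGLB_abs_zero_iff (by rintro _ ⟨n, rfl⟩; exact abs_nonneg _)]
    simp [abs_of_nonneg (hφ.nonneg (h.1 (mem_range_self _)))]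
  exact ⟨fun h f hf h0 => (key f h0).1 (h.2 f hf h0),
    fun h => ⟨hφ.monotone.isOrderBoundedFunctional, fun f hf h0 => (key f h0).2 (h f hf h0)⟩⟩

theorem isOrderContinuous_iff {φ : E →ₗ[ℝ] ℝ} (hφ : IsStrictlyPositiveFunctional φ) :
    IsOrderContinuous φ ↔ ∀ D : Set E, D.Nonempty → DirectedOn (· ≥ ·) D → IsGLB D 0 →
      ∀ ε > 0, ∃ f ∈ D, φ f < ε := by
  have key : ∀ D : Set E, IsGLB D 0 → (IsGLB ((fun f => |φ f|) '' D) 0 ↔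
      ∀ ε > 0, ∃ f ∈ D, φ f < ε) := fun D h => by
    rw [isGLB_abs_zero_iff (by rintro _ ⟨n, _, rfl⟩; exact abs_nonneg _)]
    simp only [exists_mem_image]
    refine forall₂_congr fun ε _ => exists_congr fun f => and_congr_right fun hf => ?_
    rw [abs_of_nonneg (hφ.nonneg (h.1 hf))]
  exact ⟨fun h D hD hd h0 => (key D h0).1 (h.2 D hD hd h0),
    fun h => ⟨hφ.monotone.isOrderBoundedFunctional, fun D hD hd h0 => (key D h0).2 (h D hD hd h0)⟩⟩

theorem IsOrderContinuous.isSigmaOrderContinuous {φ : E →ₗ[ℝ] ℝ} (h : IsOrderContinuous φ) :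
    IsSigmaOrderContinuous φ :=
  ⟨h.1, fun f hf h0 => by
    have := h.2 (range f) (range_nonempty f) (directedOn_range.2 hf.directed_ge) h0
    rwa [← range_comp] at this⟩

/-- A minimizing sequence in a directed set decreasing to zero decreases to zero, by strict
positivity. -/
theorem IsStrictlyPositiveFunctional.exists_antitone_isGLB {φ : E →ₗ[ℝ] ℝ}
    (hφ : IsStrictlyPositiveFunctional φ) {D : Set E} (hD : D.Nonempty)
    (hdir : DirectedOn (· ≥ ·) D) (h0 : IsGLB D 0) :
    ∃ f : ℕ → E, (∀ n, f n ∈ D) ∧ Antitone f ∧ IsGLB (range f) 0 := by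
  have hbdd : BddBelow (φ '' D) := ⟨0, by
    rintro _ ⟨f, hf, rfl⟩
    exact hφ.nonneg (h0.1 hf)⟩
  set a := sInf (φ '' D)
  have hg : ∀ n : ℕ, ∃ g ∈ D, φ g < a + 1 / ((n : ℝ) + 1) := fun n => by
    obtain ⟨_, ⟨g, hg, rfl⟩, h⟩ := exists_lt_of_csInf_lt (hD.image φ)
      (lt_add_of_pos_right a (Nat.one_div_pos_of_nat (n := n)))
    exact ⟨g, hg, h⟩
  choose g hgD hga using hg
  have hz : ∀ x y : D, ∃ z : D, (z : E) ≤ x ∧ (z : E) ≤ y := fun x y => by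
    obtain ⟨z, hz, h⟩ := hdir x x.2 y y.2
    exact ⟨⟨z, hz⟩, h⟩
  choose z hz1 hz2 using hz
  -- Each term is taken in `D` below its predecessor and below the next `g`, so the sequence is
  -- antitone and still minimizing.
  let f : ℕ → D := fun n => 
    Nat.rec (motive := fun _ => D) ⟨g 0, hgD 0⟩ (fun n x => z x ⟨g (n + 1), hgD (n + 1)⟩) n
  have hfg : ∀ n, (f n : E) ≤ g n := fun n => by
    cases n with
    | zero => exact le_rfl
    | succ n => exact hz2 (f n) _
  refine ⟨fun n => f n, fun n => (f n).2, antitone_nat_of_succ_le fun n => hz1 (f n) _, ?_, ?_⟩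
  · rintro _ ⟨n, rfl⟩
    exact h0.1 (f n).2
  · intro h hh
    refine h0.2 fun d hd => ?_
    by_contra hhd
    have hpos : 0 < h ⊔ d - d := by
      refine lt_of_le_of_ne (sub_nonneg.2 le_sup_right) fun h' => hhd ?_
      exact le_sup_left.trans (sub_eq_zero.1 h'.symm).le
    have hp := hφ _ hpos
    obtain ⟨n, hn⟩ := exists_nat_one_div_lt hp
    obtain ⟨w, hw, hwd, hwf⟩ := hdir d hd (f n) (f n).2
    -- The positive gap `h ⊔ d - d` fits below `f n - w`. Since `w ∈ D` gives `a ≤ φ w`, the value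
    -- of `φ` there is less than `1 / (n + 1)`, which contradicts the choice of `n`.
    have h1 : h ⊔ d - d ≤ f n - w := by
      rw [sub_le_iff_le_add]
      refine sup_le ?_ ?_
      · calc h ≤ f n := hh ⟨n, rfl⟩
          _ = f n - w + w := by abel
          _ ≤ f n - w + d := by gcongr
      · exact le_add_of_nonneg_left (sub_nonneg.2 hwf)
    have h2 := hφ.monotone h1
    have h3 := hφ.monotone (hfg n)
    have h4 : a ≤ φ w := csInf_le hbdd ⟨w, hw, rfl⟩
    have h5 := hga n
    rw [map_sub φ (f n : E)] at h2
    linarith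

theorem IsStrictlyPositiveFunctional.isOrderContinuous {φ : E →ₗ[ℝ] ℝ}
    (hφ : IsStrictlyPositiveFunctional φ) (h : IsSigmaOrderContinuous φ) :
    IsOrderContinuous φ := by
  rw [isOrderContinuous_iff hφ]
  intro D hD hdir h0 ε hε
  obtain ⟨f, hfD, hf, hf0⟩ := hφ.exists_antitone_isGLB hD hdir h0
  obtain ⟨n, hn⟩ := (isSigmaOrderContinuous_iff hφ).1 h f hf hf0 ε hε
  exact ⟨f n, hfD n, hn⟩

end StrictlyPositive

/-! ### Functionals on the Dedekind completion -/

namespace DedekindCompletion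

variable {X : Type*} [AddCommGroup X] [Lattice X] [IsOrderedAddMonoid X] [Module ℝ X]
  [PosSMulMono ℝ X] [IsArchimedeanVectorLattice X]

theorem embedding_pos {x : X} (hx : 0 < x) : 0 < embedding X x :=
  lt_of_le_of_ne (of_le_of.2 hx.le) fun h => hx.ne (of_injective h)

/-- A cut is determined by the elements of `X` below it, and those below a lower bound of the family
are lower bounds in `X`. -/
theorem isGLB_embedding {ι : Type*} {f : ι → X} (h : IsGLB (range f) 0) :
    IsGLB (range fun i => embedding X (f i)) 0 := by
  constructor
  · rintro _ ⟨i, rfl⟩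
    exact of_le_of.2 (h.1 (mem_range_self i))
  · intro A hA
    refine le_of_iff.2 (mem_U_iff.2 fun a ha => h.2 ?_)
    rintro _ ⟨i, rfl⟩
    exact of_le_of.1 ((of_le_iff.2 ha).trans (hA (mem_range_self i)))

theorem isStrictlyPositiveFunctional_comp_embedding {φ : DedekindCompletion X →ₗ[ℝ] ℝ}
    (hφ : IsStrictlyPositiveFunctional φ) :
    IsStrictlyPositiveFunctional (φ ∘ₗ embedding X) := fun _ hf => hφ _ (embedding_pos hf)

theorem isSigmaOrderContinuous_comp_embedding {φ : DedekindCompletion X →ₗ[ℝ] ℝ}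
    (hφ : IsStrictlyPositiveFunctional φ) (h : IsSigmaOrderContinuous φ) :
    IsSigmaOrderContinuous (φ ∘ₗ embedding X) :=
  (isSigmaOrderContinuous_iff (isStrictlyPositiveFunctional_comp_embedding hφ)).2
    fun f hf h0 => (isSigmaOrderContinuous_iff hφ).1 h (fun n => embedding X (f n))
      (fun _ _ hmn => of_le_of.2 (hf hmn)) (isGLB_embedding h0)

theorem inf_mem_U {A : DedekindCompletion X} {x y : X} (hx : x ∈ A.U) (hy : y ∈ A.U) :
    x ⊓ y ∈ A.U :=
  mem_U_iff.2 fun _ ha => le_inf (le_of_mem ha hx) (le_of_mem ha hy)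

/-- The differences `u - a` with `u` in the upper and `a` in the lower set are directed downward,
and in an Archimedean lattice their infimum is zero; order continuity applies to them. -/
theorem exists_sub_lt {φ : X →ₗ[ℝ] ℝ} (hφ : IsStrictlyPositiveFunctional φ)
    (h : IsOrderContinuous φ) (A : DedekindCompletion X) {ε : ℝ} (hε : 0 < ε) :
    ∃ a ∈ A.L, ∃ u ∈ A.U, φ u - φ a < ε := by
  obtain ⟨_, ⟨u, hu, a, ha, rfl⟩, h⟩ := (isOrderContinuous_iff hφ).1 h
    (image2 (· - ·) A.U A.L) (A.nonempty_U.image2 A.nonempty_L) (by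
      rintro _ ⟨u, hu, a, ha, rfl⟩ _ ⟨v, hv, b, hb, rfl⟩
      exact ⟨u ⊓ v - (a ⊔ b), mem_image2_of_mem (inf_mem_U hu hv) (sup_mem_L ha hb),
        sub_le_sub inf_le_left le_sup_left, sub_le_sub inf_le_right le_sup_right⟩) ⟨by
      rintro _ ⟨u, hu, a, ha, rfl⟩
      exact sub_nonneg.2 (le_of_mem ha hu), fun z hz => by
      obtain ⟨u, hu⟩ := A.nonempty_U
      obtain ⟨a, ha⟩ := A.nonempty_L
      -- A lower bound `z` of the differences translates the lower set into itself; iterating bounds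
      -- all multiples of `z` by `u - a`, so `z ≤ 0`.
      have key : ∀ n : ℕ, n • z + a ∈ A.L := fun n => by
        induction n with
        | zero => simpa using ha
        | succ n ih =>
          refine mem_L_iff.2 fun v hv => ?_
          have := hz (mem_image2_of_mem hv ih)
          rw [le_sub_iff_add_le] at this
          rwa [succ_nsmul', add_assoc]
      exact nonpos_of_nsmul_le (y := u - a) fun n => le_sub_iff_add_le.2 (le_of_mem (key n) hu)⟩ ε hε
  exact ⟨a, ha, u, hu, by simpa using h⟩

/-- The extension of a monotone functional to the Dedekind completion by suprema. -/
noncomputable def extend (φ : X →ₗ[ℝ] ℝ) (A : DedekindCompletion X) : ℝ := sSup (φ '' A.L)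

theorem le_extend {φ : X →ₗ[ℝ] ℝ} (hφ : Monotone φ) {A : DedekindCompletion X} {a : X}
    (ha : a ∈ A.L) : φ a ≤ extend φ A := by
  obtain ⟨u, hu⟩ := A.nonempty_U
  refine le_csSup ⟨φ u, ?_⟩ ⟨a, ha, rfl⟩
  rintro _ ⟨b, hb, rfl⟩
  exact hφ (le_of_mem hb hu)

theorem extend_le {φ : X →ₗ[ℝ] ℝ} (hφ : Monotone φ) {A : DedekindCompletion X} {u : X}
    (hu : u ∈ A.U) : extend φ A ≤ φ u := by
  refine csSup_le (A.nonempty_L.image φ) ?_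
  rintro _ ⟨b, hb, rfl⟩
  exact hφ (le_of_mem hb hu)

theorem eq_of_forall_abs_sub_lt {r s : ℝ} (h : ∀ ε > 0, |r - s| ≤ ε) : r = s := by
  have := le_of_forall_pos_le_add (a := |r - s|) (b := 0) fun ε hε => by simpa using h ε hε
  exact sub_eq_zero.1 (abs_nonpos_iff.1 this)

/-- Both sides lie between `φ (a + b)` and `φ (u + v)`, which `exists_sub_lt` brings within `ε` of
each other. -/
theorem extend_add {φ : X →ₗ[ℝ] ℝ} (hφ : IsStrictlyPositiveFunctional φ)
    (h : IsOrderContinuous φ) (A B : DedekindCompletion X) :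
    extend φ (A + B) = extend φ A + extend φ B := by
  refine eq_of_forall_abs_sub_lt fun ε hε => ?_
  obtain ⟨a, ha, u, hu, hau⟩ := exists_sub_lt hφ h A (half_pos hε)
  obtain ⟨b, hb, v, hv, hbv⟩ := exists_sub_lt hφ h B (half_pos hε)
  have h1 := le_extend hφ.monotone (add_mem_L ha hb)
  have h2 := extend_le hφ.monotone (A := A + B) (mem_U_add.2 fun a ha b hb =>
    add_le_add (le_of_mem ha hu) (le_of_mem hb hv))
  have h3 := le_extend hφ.monotone ha
  have h4 := le_extend hφ.monotone hb
  have h5 := extend_le hφ.monotone hu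
  have h6 := extend_le hφ.monotone hv
  rw [map_add] at h1 h2
  exact abs_le.2 ⟨by linarith, by linarith⟩

theorem extend_nnsmul {φ : X →ₗ[ℝ] ℝ} (hφ : IsStrictlyPositiveFunctional φ)
    (h : IsOrderContinuous φ) (c : NNReal) (A : DedekindCompletion X) :
    extend φ (nnsmul c A) = c * extend φ A := by
  refine eq_of_forall_abs_sub_lt fun ε hε => ?_
  have hc : (0 : ℝ) ≤ c := c.2
  -- Dividing by `c + 1` rather than `c` covers `c = 0` as well.
  obtain ⟨a, ha, u, hu, hau⟩ := exists_sub_lt hφ h A (ε := ε / (c + 1)) (by positivity)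
  have h1 := le_extend hφ.monotone (smul_mem_L_nnsmul (c := c) ha)
  have h2 := extend_le hφ.monotone (A := nnsmul c A) (mem_U_nnsmul.2 fun a ha =>
    smul_le_smul_of_nonneg_left (le_of_mem ha hu) hc)
  have h3 := mul_le_mul_of_nonneg_left (le_extend hφ.monotone ha) hc
  have h5 := mul_le_mul_of_nonneg_left (extend_le hφ.monotone hu) hc
  rw [map_smul, smul_eq_mul] at h1 h2
  have h7 : c * (φ u - φ a) ≤ ε := by
    calc c * (φ u - φ a) ≤ c * (ε / (c + 1)) := by gcongr
      _ = ε * (c / (c + 1)) := by ring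
      _ ≤ ε * 1 := by
        gcongr
        exact div_le_one_of_le₀ (by linarith) (by positivity)
      _ = ε := mul_one ε
  rw [mul_sub] at h7
  exact abs_le.2 ⟨by linarith, by linarith⟩

/-- A strictly positive order continuous functional extends to a linear functional on the Dedekind
completion. -/
noncomputable def extendₗ {φ : X →ₗ[ℝ] ℝ} (hφ : IsStrictlyPositiveFunctional φ)
    (h : IsOrderContinuous φ) : DedekindCompletion X →ₗ[ℝ] ℝ where
  toFun := extend φ
  map_add' := extend_add hφ h
  map_smul' c A := by
    let f : DedekindCompletion X →+ ℝ := AddMonoidHom.mk' (extend φ) (extend_add hφ h)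
    change f (c • A) = c * f A
    obtain ⟨p, q, rfl⟩ := exists_eq_sub c
    have h1 : ∀ r : NNReal, f (nnsmul r A) = r * f A := fun r => extend_nnsmul hφ h r A
    rw [smul_eq_of_sub, map_sub, h1, h1, sub_mul]

theorem isStrictlyPositiveFunctional_extendₗ {φ : X →ₗ[ℝ] ℝ}
    (hφ : IsStrictlyPositiveFunctional φ) (h : IsOrderContinuous φ) :
    IsStrictlyPositiveFunctional (extendₗ hφ h) := fun A hA => by
  obtain ⟨x, hx, hxA⟩ := isDedekindCompletion_embedding.orderDense A hA
  have hx' : 0 < x := lt_of_le_of_ne (of_le_of.1 hx.le) fun h => by simp [← h] at hx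
  exact (hφ x hx').trans_le (le_extend hφ.monotone (of_le_iff.1 hxA))

/-- The union of the upper sets of the cuts in `D` is directed down to zero inside `X`, and the
extension at a cut is at most `φ` on its upper set. -/
theorem isOrderContinuous_extendₗ {φ : X →ₗ[ℝ] ℝ}
    (hφ : IsStrictlyPositiveFunctional φ) (h : IsOrderContinuous φ) :
    IsOrderContinuous (extendₗ hφ h) := by
  rw [isOrderContinuous_iff (isStrictlyPositiveFunctional_extendₗ hφ h)]
  rintro D ⟨A₀, hA₀⟩ hdir h0 ε hε
  obtain ⟨u₀, hu₀⟩ := A₀.nonempty_U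
  obtain ⟨x, hx, hxε⟩ := (isOrderContinuous_iff hφ).1 h (⋃ A ∈ D, A.U)
    ⟨u₀, mem_biUnion hA₀ hu₀⟩ (by
      intro x hx y hy
      obtain ⟨A, hA, hxA⟩ := mem_iUnion₂.1 hx
      obtain ⟨B, hB, hyB⟩ := mem_iUnion₂.1 hy
      obtain ⟨C, hC, hCA, hCB⟩ := hdir A hA B hB
      exact ⟨x ⊓ y, mem_biUnion hC (inf_mem_U (le_iff_U.1 hCA hxA) (le_iff_U.1 hCB hyB)),
        inf_le_left, inf_le_right⟩) ⟨by
      intro x hx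
      obtain ⟨A, hA, hxA⟩ := mem_iUnion₂.1 hx
      exact of_le_of.1 ((h0.1 hA).trans (le_of_iff.2 hxA)), fun z hz => by
      refine of_le_of.1 (h0.2 fun A hA => of_le_iff.2 (mem_L_iff.2 fun u hu => ?_))
      exact hz (mem_biUnion hA hu)⟩ ε hε
  obtain ⟨A, hA, hxA⟩ := mem_iUnion₂.1 hx
  exact ⟨A, hA, (extend_le hφ.monotone hxA).trans_lt hxε⟩

end DedekindCompletion

/-! ### Functions on compact spaces -/

section Urysohn

variable {K : Type*} [TopologicalSpace K] [CompactSpace K] [T2Space K]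

theorem IsOpen.not_isMeagre {U : Set K} (hU : IsOpen U) (h : U.Nonempty) : ¬ IsMeagre U := by
  intro hm
  obtain ⟨x, hx, hx'⟩ := (dense_of_mem_residual hm).inter_open_nonempty U hU h
  exact hx' hx

/-- A nonempty open set supports a function `0 ≤ f ≤ 1` that is one at a given point. -/
theorem exists_bump {U : Set K} (hU : IsOpen U) {x : K} (hx : x ∈ U) :
    ∃ f : C(K, ℝ), (∀ y ∉ U, f y = 0) ∧ f x = 1 ∧ ∀ y, f y ∈ Icc (0 : ℝ) 1 := by
  obtain ⟨f, h0, h1, h⟩ := exists_continuous_zero_one_of_isClosed hU.isClosed_compl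
    (isClosed_singleton (x := x)) (by simpa using hx)
  exact ⟨f, fun y hy => h0 hy, h1 rfl, h⟩

theorem bump_pos {f : C(K, ℝ)} {x : K} (hx : f x = 1) (h : ∀ y, f y ∈ Icc (0 : ℝ) 1) : 0 < f :=
  lt_of_le_of_ne (fun y => (h y).1) fun h0 => by
    rw [← h0] at hx
    simp at hx

/-- If nonnegative continuous functions have infimum zero then their pointwise infimum is zero on
a comeagre set. -/
theorem isMeagre_forall_ge_of_isGLB {f : ℕ → C(K, ℝ)} (h0 : IsGLB (range f) 0) {ε : ℝ}
    (hε : 0 < ε) : IsMeagre {x | ∀ n, ε ≤ f n x} := by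
  have hc : IsClosed {x | ∀ n, ε ≤ f n x} := by
    rw [ofPred_forall]
    exact isClosed_iInter fun n => isClosed_le continuous_const (f n).continuous
  refine IsNowhereDense.isMeagre (hc.isNowhereDense_iff.2 ?_)
  by_contra hne
  obtain ⟨x, hx⟩ := nonempty_iff_ne_empty.2 hne
  obtain ⟨g, hg0, hg1, hg⟩ := exists_bump isOpen_interior hx
  -- If the closed set had interior, `ε` times a bump supported there would be a nonzero positive
  -- lower bound of all `f n`.
  have hle : ε • g ≤ 0 := h0.2 (by
    rintro _ ⟨n, rfl⟩ y
    have hfy : 0 ≤ f n y := h0.1 (mem_range_self n) y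
    by_cases hy : y ∈ interior {x | ∀ n, ε ≤ f n x}
    · have := interior_subset hy n
      have h2 := (hg y).2
      change ε * g y ≤ f n y
      nlinarith
    · change ε * g y ≤ f n y
      rwa [hg0 y hy, mul_zero])
  have := hle x
  change ε * g x ≤ 0 at this
  rw [hg1] at this
  linarith

end Urysohn

/-! ### Consequences of the existence of a category measure -/

section CategoryMeasure

open MeasureTheory

variable {K : Type*} [TopologicalSpace K] [CompactSpace K] [T2Space K]

/-- Integration against a measure whose null sets contain the meagre sets and no nonempty open set
is strictly positive and `σ`-order continuous. -/
theorem exists_sigmaOrderContinuous_of_measure [MeasurableSpace K] [BorelSpace K]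
    (μ : Measure K) [IsFiniteMeasure μ] (hμ : ∀ A, MeasurableSet A → (μ A = 0 ↔ IsMeagre A)) :
    ∃ φ : C(K, ℝ) →ₗ[ℝ] ℝ, IsStrictlyPositiveFunctional φ ∧ IsSigmaOrderContinuous φ := by
  have hint : ∀ f : C(K, ℝ), Integrable f μ := fun f =>
    (BoundedContinuousFunction.mkOfCompact f).integrable μ
  let φ : C(K, ℝ) →ₗ[ℝ] ℝ :=
    { toFun := fun f => ∫ x, f x ∂μ
      map_add' := fun f g => integral_add (hint f) (hint g)
      map_smul' := fun c f => integral_const_mul c f }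
  have hpos : IsStrictlyPositiveFunctional φ := fun f hf => by
    have hf0 : 0 ≤ (f : K → ℝ) := hf.le
    refine (integral_pos_iff_support_of_nonneg hf0 (hint f)).2 (pos_iff_ne_zero.2 fun h => ?_)
    have hopen : IsOpen (Function.support f) := f.continuous.isOpen_support
    refine hopen.not_isMeagre ?_ ((hμ _ hopen.measurableSet).1 h)
    rw [Function.support_nonempty_iff]
    exact fun h' => hf.ne' (DFunLike.coe_injective h')
  refine ⟨φ, hpos, (isSigmaOrderContinuous_iff hpos).2 fun f hf h0 ε hε => ?_⟩
  -- The points where the sequence stays above `1 / (k + 1)` form a meagre, hence null, set for each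
  -- `k`; monotonicity turns this into convergence.
  have hae : ∀ᵐ x ∂μ, Filter.Tendsto (fun n => f n x) Filter.atTop (nhds 0) := by
    have h1 : ∀ k : ℕ, ∀ᵐ x ∂μ, ∃ n, f n x < 1 / ((k : ℝ) + 1) := fun k => by
      have hc : IsClosed {x | ∀ n, 1 / ((k : ℝ) + 1) ≤ f n x} := by
        rw [ofPred_forall]
        exact isClosed_iInter fun n => isClosed_le continuous_const (f n).continuous
      have := (hμ _ hc.measurableSet).2 (isMeagre_forall_ge_of_isGLB h0 Nat.one_div_pos_of_nat)
      rw [ae_iff]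
      simpa only [not_exists, not_lt] using this
    filter_upwards [ae_all_iff.2 h1] with x hx
    rw [Metric.tendsto_atTop]
    intro δ hδ
    obtain ⟨k, hk⟩ := exists_nat_one_div_lt hδ
    obtain ⟨n, hn⟩ := hx k
    refine ⟨n, fun m hm => ?_⟩
    have h2 : f m x ≤ f n x := hf hm x
    have h3 : 0 ≤ f m x := h0.1 (mem_range_self m) x
    rw [Real.dist_eq, sub_zero, abs_of_nonneg h3]
    linarith
  have hlim : Filter.Tendsto (fun n => ∫ x, f n x ∂μ) Filter.atTop (nhds (∫ x, (0 : ℝ) ∂μ)) :=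
    tendsto_integral_of_dominated_convergence (fun x => f 0 x)
      (fun n => (hint (f n)).aestronglyMeasurable) (hint (f 0)) (fun n => ae_of_all _ fun x => by
        have h2 : f n x ≤ f 0 x := hf (Nat.zero_le n) x
        have h3 : 0 ≤ f n x := h0.1 (mem_range_self n) x
        rwa [Real.norm_eq_abs, abs_of_nonneg h3]) hae
  rw [integral_zero] at hlim
  exact (hlim.eventually_lt_const hε).exists

/-- Continuous functions only need the Borel sets, so the category measure is restricted to them. -/
theorem exists_sigmaOrderContinuous_of_isCategoryMeasure
    {μ : @Measure K (eventuallyMeasurableSpace (borel K) (residual K))}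
    (hμ : IsCategoryMeasure μ) :
    ∃ φ : C(K, ℝ) →ₗ[ℝ] ℝ, IsStrictlyPositiveFunctional φ ∧ IsSigmaOrderContinuous φ := by
  let _ : MeasurableSpace K := borel K
  have : BorelSpace K := ⟨rfl⟩
  have hle : borel K ≤ eventuallyMeasurableSpace (borel K) (residual K) :=
    le_eventuallyMeasurableSpace
  have : IsFiniteMeasure (μ.trim hle) := ⟨by
    rw [trim_measurableSet_eq hle MeasurableSet.univ]
    exact hμ.1⟩
  refine exists_sigmaOrderContinuous_of_measure (μ.trim hle) fun A hA => ?_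
  rw [trim_measurableSet_eq hle hA]
  exact hμ.2 A hA.baireMeasurableSet

/-! ### Measures and Kelley numbers -/

open Classical in
theorem card_le_maxIntersecting {X : Type*} {n : ℕ} (F : Fin n → Set X) (x : X) :
    (Finset.univ.filter fun j => x ∈ F j).card ≤ maxIntersecting F := by
  unfold maxIntersecting
  refine Finset.le_sup (f := Finset.card) (Finset.mem_filter.2 ⟨Finset.mem_univ _, x, ?_⟩)
  simp

/-- A collection of sets of measure at least `δ` has Kelley number at least `δ / μ univ`. -/
theorem le_kelleyNumber {X : Type*} [MeasurableSpace X] (μ : Measure X) [IsFiniteMeasure μ]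
    {𝓕 : Set (Set X)} {δ : ENNReal} (h𝓕 : ∀ A ∈ 𝓕, MeasurableSet A ∧ δ ≤ μ A) :
    δ / μ univ ≤ kelleyNumber 𝓕 := by
  classical
  refine le_iInf fun n => le_iInf fun hn => le_iInf fun F => le_iInf fun hF => ?_
  have hn0 : (n : ENNReal) ≠ 0 := by exact_mod_cast hn.ne'
  rw [ENNReal.le_div_iff_mul_le (Or.inl hn0) (Or.inl (ENNReal.natCast_ne_top n))]
  rw [mul_comm, ← mul_div_assoc]
  refine ENNReal.div_le_of_le_mul ?_
  -- Double counting: the number of `F j` containing a point never exceeds `maxIntersecting F`, and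
  -- its integral is the sum of the measures.
  calc (n : ENNReal) * δ = ∑ j : Fin n, δ := by simp
    _ ≤ ∑ j : Fin n, μ (F j) := Finset.sum_le_sum fun j _ => (h𝓕 _ (hF j)).2
    _ = ∑ j : Fin n, ∫⁻ x, (F j).indicator 1 x ∂μ :=
      Finset.sum_congr rfl fun j _ => (lintegral_indicator_one (h𝓕 _ (hF j)).1).symm
    _ = ∫⁻ x, ∑ j : Fin n, (F j).indicator 1 x ∂μ :=
      (lintegral_finsetSum _ fun j _ => measurable_one.indicator (h𝓕 _ (hF j)).1).symm
    _ ≤ ∫⁻ x, maxIntersecting F ∂μ := lintegral_mono fun x => by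
      refine le_trans ?_ (Nat.cast_le.2 (card_le_maxIntersecting F x))
      simp [indicator_apply]
    _ = maxIntersecting F * μ univ := lintegral_const _

/-- The classes are dyadic shells of the measure. The strict lower bound passes to some stage of an
increasing union, the upper bound passes to all stages, and both ignore meagre changes. -/
theorem propertyTripleStar_of_isCategoryMeasure
    {μ : @Measure K (eventuallyMeasurableSpace (borel K) (residual K))}
    (hμ : IsCategoryMeasure μ) : PropertyTripleStar K := by
  let _ : MeasurableSpace K := eventuallyMeasurableSpace (borel K) (residual K)
  have : IsFiniteMeasure μ := ⟨hμ.1⟩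
  have hpos : ∀ U : Set K, IsOpen U → U.Nonempty → μ U ≠ 0 := fun U hU hne h =>
    hU.not_isMeagre hne ((hμ.2 U hU.baireMeasurableSet).1 h)
  have htop : ∀ U : Set K, μ U ≠ ⊤ := measure_ne_top μ
  let b : ℕ → ENNReal := fun n => μ univ / 2 ^ n
  have hb : Antitone b := fun m n hmn => by
    refine ENNReal.div_le_div_left ?_ _
    exact pow_le_pow_right₀ (by norm_num) hmn
  have hb0 : ∀ ε : ENNReal, ε ≠ 0 → ∃ n, b n < ε := fun ε hε => by
    have h1 : Filter.Tendsto b Filter.atTop (nhds 0) := by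
      have := ENNReal.Tendsto.const_mul (a := μ univ)
        (ENNReal.tendsto_pow_atTop_nhds_zero_of_lt_one (r := 2⁻¹) (by norm_num))
        (Or.inr (htop univ))
      rw [mul_zero] at this
      refine this.congr fun n => ?_
      rw [← ENNReal.inv_pow]
      rfl
    exact (h1.eventually_lt_const (pos_iff_ne_zero.2 hε)).exists
  refine ⟨fun n => {U | IsOpen U ∧ U.Nonempty ∧ b (n + 1) < μ U ∧ μ U ≤ b n}, ?_, ?_, ?_⟩
  · have key : ∀ m n, m < n → ∀ U : Set K, b (m + 1) < μ U → μ U ≤ b n → False :=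
      fun m n hmn U h1 h2 => absurd (h2.trans (hb (Nat.succ_le_of_lt hmn))) (not_le.2 h1)
    intro m n hmn
    refine disjoint_left.2 ?_
    rintro U ⟨-, -, h1, h2⟩ ⟨-, -, h3, h4⟩
    rcases lt_or_gt_of_ne hmn with h | h
    · exact key m n h U h1 h4
    · exact key n m h U h3 h2
  · ext U
    simp only [mem_iUnion, mem_ofPred_eq]
    constructor
    · rintro ⟨n, h1, h2, -⟩
      exact ⟨h1, h2⟩
    · rintro ⟨h1, h2⟩
      classical
      have hex := hb0 _ (hpos U h1 h2)
      -- The first threshold below `μ U` is not `b 0 = μ univ`, so it has a predecessor, which gives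
      -- the upper bound.
      obtain ⟨k, hk⟩ : ∃ k, Nat.find hex = k + 1 := Nat.exists_eq_succ_of_ne_zero fun h => by
        have := Nat.find_spec hex
        rw [h] at this
        simp only [b, pow_zero, div_one] at this
        exact absurd (measure_mono (subset_univ U)) (not_le.2 this)
      refine ⟨k, h1, h2, ?_, ?_⟩
      · rw [← hk]
        exact Nat.find_spec hex
      · exact not_lt.1 (Nat.find_min hex (by omega))
  · intro n
    refine ⟨?_, ?_, ?_⟩
    -- Here the classes are empty; the quotient bound of `le_kelleyNumber` would only give `0 / 0 =
    -- 0`.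
    · by_cases hK : μ univ = 0
      · unfold kelleyNumber
        have : ∀ U : Set K, ¬ (IsOpen U ∧ U.Nonempty ∧ b (n + 1) < μ U ∧ μ U ≤ b n) :=
          fun U hU => hpos U hU.1 hU.2.1 (measure_mono_null (subset_univ U) hK)
        have h2 : ∀ m, 0 < m → ∀ F : Fin m → Set K, ¬ ∀ j, F j ∈
            {U : Set K | IsOpen U ∧ U.Nonempty ∧ b (n + 1) < μ U ∧ μ U ≤ b n} :=
          fun m hm F hF => this _ (hF ⟨0, hm⟩)
        refine lt_of_lt_of_le one_pos (le_iInf fun m => le_iInf fun hm => le_iInf fun F =>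
          le_iInf fun hF => (h2 m hm F hF).elim)
      · refine lt_of_lt_of_le ?_ (le_kelleyNumber μ (δ := b (n + 1)) fun U hU =>
          ⟨hU.1.baireMeasurableSet, hU.2.2.1.le⟩)
        refine ENNReal.div_pos ?_ (htop univ)
        exact (ENNReal.div_pos hK (by finiteness)).ne'
    · rintro U hU hmono ⟨-, hne, h1, h2⟩
      have hlim := tendsto_measure_iUnion_atTop (μ := μ) hmono
      obtain ⟨m, hm⟩ := (hlim.eventually_const_lt h1).exists
      refine ⟨m, hU m, ?_, hm, (measure_mono (subset_iUnion U m)).trans h2⟩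
      rw [nonempty_iff_ne_empty]
      intro h
      simp [h] at hm
    · rintro U V ⟨hU, hne, h1, h2⟩ hV hUV
      have h0 : μ (symmDiff U V) = 0 := (hμ.2 _ hUV.baireMeasurableSet).2 hUV
      have heq : μ U = μ V := measure_congr (measure_symmDiff_eq_zero_iff.1 h0)
      refine ⟨hV, ?_, heq ▸ h1, heq ▸ h2⟩
      rw [nonempty_iff_ne_empty]
      intro h
      rw [heq, h, measure_empty] at h1
      exact absurd h1 (not_lt.2 zero_le)

end CategoryMeasure

/-! ### The category measure of an order continuous functional -/

section RieszMeasure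

open MeasureTheory

variable {K : Type*} [TopologicalSpace K]

/-- Meagre sets are null, so sets with the property of Baire are null measurable and the completion
of `μ` restricts to them. A null set differs by a meagre set from a null open set, which must be
empty. -/
theorem exists_isCategoryMeasure_of_measure [MeasurableSpace K] [BorelSpace K] (μ : Measure K)
    [IsFiniteMeasure μ] (h0 : ∀ A : Set K, IsClosed A → IsNowhereDense A → μ A = 0)
    (hpos : ∀ U : Set K, IsOpen U → U.Nonempty → μ U ≠ 0) :
    ∃ ν : @Measure K (eventuallyMeasurableSpace (borel K) (residual K)), IsCategoryMeasure ν := by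
  have hm : ∀ A : Set K, IsMeagre A → μ A = 0 := fun A hA => by
    obtain ⟨S, hS, hSc, hAS⟩ := isMeagre_iff_countable_union_isNowhereDense.1 hA
    refine measure_mono_null hAS ((measure_sUnion_null_iff hSc).2 fun s hs => ?_)
    exact measure_mono_null subset_closure (h0 _ isClosed_closure (hS s hs).closure)
  have hae : ae μ ≤ residual K := fun A hA => by
    rw [mem_ae_iff]
    refine hm _ ?_
    rwa [IsMeagre, compl_compl]
  have hle : eventuallyMeasurableSpace (borel K) (residual K) ≤
      (inferInstance : MeasurableSpace (NullMeasurableSpace K μ)) := by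
    rintro A ⟨t, ht, hAt⟩
    refine ⟨t, ?_, hAt.filter_mono hae⟩
    rwa [‹BorelSpace K›.measurable_eq]
  obtain ⟨ν, hν⟩ : ∃ ν : @Measure K (eventuallyMeasurableSpace (borel K) (residual K)),
      ∀ A, BaireMeasurableSet A → ν A = μ A :=
    ⟨μ.completion.trim hle, fun A hA => trim_measurableSet_eq hle hA⟩
  refine ⟨ν, ?_, fun A hA => ?_⟩
  · rw [hν univ MeasurableSet.univ]
    exact measure_lt_top μ univ
  · rw [hν A hA]
    refine ⟨fun hA0 => ?_, hm A⟩
    obtain ⟨U, hU, hAU⟩ := hA.residualEq_isOpen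
    have hU0 : μ U = 0 := by
      rw [← measure_congr (hAU.filter_mono hae)]
      exact hA0
    have hUe : U = ∅ := by
      by_contra hne
      exact hpos U hU (nonempty_iff_ne_empty.2 hne) hU0
    rw [hUe] at hAU
    exact Filter.eventuallyEq_empty.1 hAU

variable [CompactSpace K] [T2Space K]

/-- The continuous functions between the indicator of a closed nowhere dense set and one decrease
to zero. -/
theorem isGLB_of_isNowhereDense {A : Set K} (hA : IsClosed A) (hA' : IsNowhereDense A) :
    IsGLB {f : C(K, ℝ) | 0 ≤ f ∧ ∀ x ∈ A, 1 ≤ f x} 0 := by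
  refine ⟨fun f hf => hf.1, fun g hg => ?_⟩
  have hd : Dense Aᶜ := interior_eq_empty_iff_dense_compl.1 (hA.isNowhereDense_iff.1 hA')
  have hc : IsClosed {x | g x ≤ 0} := isClosed_le g.continuous continuous_const
  -- A Urysohn function vanishing at `x` and equal to one on `A` belongs to the set, so a lower
  -- bound is nonpositive off `A`, and by density everywhere.
  have hsub : Aᶜ ⊆ {x | g x ≤ 0} := fun x hx => by
    obtain ⟨f, hfx, hfA, hf⟩ := exists_continuous_zero_one_of_isClosed
      (isClosed_singleton (x := x)) hA (by simpa using hx)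
    have h1 := hg (show f ∈ {f : C(K, ℝ) | 0 ≤ f ∧ ∀ x ∈ A, 1 ≤ f x} from
      ⟨fun y => (hf y).1, fun y hy => (hfA hy).ge⟩) x
    exact h1.trans (hfx rfl).le
  intro x
  exact hc.closure_subset_iff.2 hsub (hd x)

/-- On a compact space Riesz–Markov represents `φ` by a measure. Order continuity yields functions
of small integral above a closed nowhere dense set; strict positivity, applied to bumps, gives
nonempty open sets positive measure. -/
theorem exists_isCategoryMeasure_of_isOrderContinuous {φ : C(K, ℝ) →ₗ[ℝ] ℝ}
    (hφ : IsStrictlyPositiveFunctional φ) (h : IsOrderContinuous φ) :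
    ∃ ν : @Measure K (eventuallyMeasurableSpace (borel K) (residual K)), IsCategoryMeasure ν := by
  let _ : MeasurableSpace K := borel K
  have : BorelSpace K := ⟨rfl⟩
  let Λ : CompactlySupportedContinuousMap K ℝ →ₚ[ℝ] ℝ :=
    { toFun := fun g => φ g.toContinuousMap
      map_add' := fun f g => φ.map_add f.toContinuousMap g.toContinuousMap
      map_smul' := fun c f => φ.map_smul c f.toContinuousMap
      monotone' := fun f g hfg => hφ.monotone hfg }
  have hint : ∀ f : C(K, ℝ), ∫ x, f x ∂(RealRMK.rieszMeasure Λ) = φ f := fun f =>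
    RealRMK.integral_rieszMeasure Λ (CompactlySupportedContinuousMap.continuousMapEquiv f)
  have hintegrable : ∀ f : C(K, ℝ), Integrable f (RealRMK.rieszMeasure Λ) := fun f =>
    (BoundedContinuousFunction.mkOfCompact f).integrable _
  refine exists_isCategoryMeasure_of_measure (RealRMK.rieszMeasure Λ) (fun A hA hA' => ?_)
    fun U hU ⟨x, hx⟩ h0 => ?_
  · refine (measureReal_eq_zero_iff).1 (le_antisymm (le_of_forall_pos_le_add fun ε hε => ?_)
      measureReal_nonneg)
    obtain ⟨f, ⟨hf0, hf1⟩, hfε⟩ := (isOrderContinuous_iff hφ).1 h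
      {f : C(K, ℝ) | 0 ≤ f ∧ ∀ x ∈ A, 1 ≤ f x} ⟨1, fun x => zero_le_one, fun x _ => le_rfl⟩ (by
        rintro f ⟨hf0, hf1⟩ g ⟨hg0, hg1⟩
        exact ⟨f ⊓ g, ⟨le_inf hf0 hg0, fun x hx => le_inf (hf1 x hx) (hg1 x hx)⟩,
          inf_le_left, inf_le_right⟩) (isGLB_of_isNowhereDense hA hA') ε hε
    rw [zero_add, ← integral_indicator_one hA.measurableSet]
    refine le_trans ?_ ((hint f).trans_lt hfε).le
    refine integral_mono ((integrable_const (1 : ℝ)).indicator hA.measurableSet) (hintegrable f)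
      fun x => ?_
    by_cases hx : x ∈ A
    · simpa [hx] using hf1 x hx
    · simpa [hx] using hf0 x
  · obtain ⟨f, hfU, hfx, hf⟩ := exists_bump hU hx
    refine (hφ f (bump_pos hfx hf)).ne' ?_
    rw [← hint f]
    refine integral_eq_zero_of_ae ?_
    rw [Filter.EventuallyEq, ae_iff]
    exact measure_mono_null (fun y hy => by_contra fun hyU => hy (hfU y hyU)) h0

end RieszMeasure

/-! ### Kelley's theorem -/

section Kelley

/-- Passing from finite sequences to real weights in the definition of the Kelley number. -/
theorem exists_sum_ge_of_le_kelleyNumber {X : Type*} [Nonempty X] {𝓕 : Set (Set X)} {k : ℝ}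
    (hk : ENNReal.ofReal k ≤ kelleyNumber 𝓕) (hk0 : 0 ≤ k) {ι : Type*} [Fintype ι]
    {F : ι → Set X} (hF : ∀ i, F i ∈ 𝓕) (a : ι → ℝ) (ha : ∀ i, 0 ≤ a i) {ε : ℝ} (hε : 0 < ε) :
    ∃ J : Finset ι, (⋂ i ∈ J, F i).Nonempty ∧ k * ∑ i, a i ≤ ∑ i ∈ J, a i + ε := by
  classical
  rcases isEmpty_or_nonempty ι with _ | _
  · exact ⟨∅, by simp, by simpa using hε.le⟩
  have hc : (0 : ℝ) < Fintype.card ι := by exact_mod_cast Fintype.card_pos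
  obtain ⟨N, hN⟩ := exists_nat_gt (Fintype.card ι / ε)
  have hN0 : (0 : ℝ) < N := (div_pos hc hε).trans hN
  -- `F i` is repeated `m i` times. Adding one keeps the sequence nonempty and makes `m i` an upper
  -- approximation of `N * a i`; the total excess is at most the number of indices, which is at most
  -- `N * ε`.
  let m : ι → ℕ := fun i => ⌊(N : ℝ) * a i⌋₊ + 1
  have hm1 : ∀ i, N * a i ≤ m i := fun i => by
    simpa [m] using (Nat.lt_floor_add_one ((N : ℝ) * a i)).le
  have hm2 : ∀ i, (m i : ℝ) ≤ N * a i + 1 := fun i => by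
    simpa [m] using Nat.floor_le (mul_nonneg hN0.le (ha i))
  let e : (Σ i, Fin (m i)) ≃ Fin (Fintype.card (Σ i, Fin (m i))) := Fintype.equivFin _
  have hcard : Fintype.card (Σ i, Fin (m i)) = ∑ i, m i := by simp
  set n := Fintype.card (Σ i, Fin (m i))
  have hn : 0 < n := Fintype.card_pos_iff.2 ⟨⟨Classical.arbitrary ι, ⟨0, Nat.succ_pos _⟩⟩⟩
  let G : Fin n → Set X := fun j => F (e.symm j).1
  have h1 : ENNReal.ofReal k ≤ (maxIntersecting G : ENNReal) / n :=
    hk.trans (iInf_le_of_le n (iInf_le_of_le hn (iInf_le_of_le G (iInf_le _ fun j => hF _))))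
  have hne : (Finset.univ.filter fun J : Finset (Fin n) => (⋂ j ∈ J, G j).Nonempty).Nonempty :=
    ⟨∅, by simp⟩
  obtain ⟨J, hJ, hJmax⟩ := Finset.exists_mem_eq_sup _ hne Finset.card
  have h2 : maxIntersecting G = J.card := hJmax
  have hJne := (Finset.mem_filter.1 hJ).2
  obtain ⟨x, hx⟩ := hJne
  -- The maximal intersecting family of repetitions is enlarged to all sets containing a common
  -- point of it.
  refine ⟨Finset.univ.filter fun i => x ∈ F i, ⟨x, by simp⟩, ?_⟩
  have h3 : k * n ≤ J.card := by
    rw [h2, ENNReal.le_div_iff_mul_le (Or.inl (by exact_mod_cast hn.ne'))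
      (Or.inl (ENNReal.natCast_ne_top n)), ← ENNReal.ofReal_natCast, ← ENNReal.ofReal_natCast,
      ← ENNReal.ofReal_mul hk0, ENNReal.ofReal_le_ofReal_iff (Nat.cast_nonneg _)] at h1
    exact h1
  have h4 : J.card ≤ ∑ i ∈ Finset.univ.filter (fun i => x ∈ F i), m i := by
    have : J.map e.symm.toEmbedding ⊆
        (Finset.univ.filter fun i => x ∈ F i).sigma fun i => Finset.univ := by
      intro p hp
      obtain ⟨j, hj, rfl⟩ := Finset.mem_map.1 hp
      have := mem_iInter₂.1 hx j hj
      simpa using this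
    have := Finset.card_le_card this
    simpa using this
  have h5 : (N : ℝ) * ∑ i, a i ≤ n := by
    rw [hcard, Finset.mul_sum]
    push_cast
    exact Finset.sum_le_sum fun i _ => hm1 i
  have h6 : ((∑ i ∈ Finset.univ.filter (fun i => x ∈ F i), m i : ℕ) : ℝ) ≤
      N * ∑ i ∈ Finset.univ.filter (fun i => x ∈ F i), a i + Fintype.card ι := by
    push_cast
    calc _ ≤ ∑ i ∈ Finset.univ.filter (fun i => x ∈ F i), ((N : ℝ) * a i + 1) :=
          Finset.sum_le_sum fun i _ => hm2 i
      _ ≤ _ := by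
        rw [Finset.sum_add_distrib, ← Finset.mul_sum]
        gcongr
        simpa using Finset.card_le_univ (Finset.univ.filter fun i => x ∈ F i)
  have h7 : (Fintype.card ι : ℝ) ≤ N * ε := by
    rw [div_lt_iff₀ hε] at hN
    exact hN.le
  have h8 : (J.card : ℝ) ≤ (∑ i ∈ Finset.univ.filter (fun i => x ∈ F i), m i : ℕ) := by
    exact_mod_cast h4
  refine le_of_mul_le_mul_left ?_ hN0
  calc (N : ℝ) * (k * ∑ i, a i) = k * (N * ∑ i, a i) := by ring
    _ ≤ k * n := by gcongr
    _ ≤ N * (∑ i ∈ Finset.univ.filter (fun i => x ∈ F i), a i + ε) := by linarith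

end Kelley

/-! ### Finitely additive measures and their countably additive parts -/

section FinitelyAdditive

open MeasureTheory Filter

variable {K : Type*} [TopologicalSpace K]

theorem isMeagre_symmDiff_iff {A B : Set K} :
    IsMeagre (symmDiff A B) ↔ A =ᶠ[residual K] B := by
  rw [IsMeagre, Filter.eventuallyEq_set]
  refine iff_of_eq (congrArg (· ∈ residual K) ?_)
  ext x
  simp only [mem_compl_iff, mem_symmDiff, mem_ofPred_eq]
  tauto

/-- A finitely additive measure on all subsets of `K`, normalized and vanishing on the meagre
sets. -/
structure IsMeagreNullContent (m : Set K → ℝ) : Prop where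
  nonneg : ∀ A, 0 ≤ m A
  union : ∀ A B, Disjoint A B → m (A ∪ B) = m A + m B
  meagre : ∀ A, IsMeagre A → m A = 0
  univ : m univ = 1

namespace IsMeagreNullContent

variable {m : Set K → ℝ}

theorem inter_add_diff (hm : IsMeagreNullContent m) (A B : Set K) : m (A ∩ B) + m (A \ B) = m A := by
  rw [← hm.union _ _ (disjoint_sdiff_inter.symm), inter_union_sdiff]

theorem mono (hm : IsMeagreNullContent m) {A B : Set K} (h : A ⊆ B) : m A ≤ m B := by
  rw [← hm.inter_add_diff B A, inter_eq_self_of_subset_right h]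
  exact le_add_of_nonneg_right (hm.nonneg _)

theorem union_le (hm : IsMeagreNullContent m) (A B : Set K) : m (A ∪ B) ≤ m A + m B := by
  rw [← union_sdiff_self, hm.union _ _ disjoint_sdiff_right]
  gcongr
  exact hm.mono sdiff_subset

theorem congr (hm : IsMeagreNullContent m) {A B : Set K} (h : A =ᶠ[residual K] B) : m A = m B := by
  have key : ∀ {A B : Set K}, A =ᶠ[residual K] B → m A ≤ m B := fun {A B} h => by
    have h1 : A ⊆ B ∪ symmDiff A B := fun x hx => by
      by_cases hB : x ∈ B
      · exact Or.inl hB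
      · exact Or.inr (Or.inl ⟨hx, hB⟩)
    have h2 := (hm.mono h1).trans (hm.union_le _ _)
    rwa [hm.meagre _ (isMeagre_symmDiff_iff.2 h), add_zero] at h2
  exact le_antisymm (key h) (key h.symm)

theorem accumulate_le (hm : IsMeagreNullContent m) (s : ℕ → Set K) (n : ℕ) :
    m (accumulate s n) ≤ ∑ i ∈ Finset.range (n + 1), m (s i) := by
  induction n with
  | zero => simp
  | succ n ih =>
    rw [accumulate_succ, Finset.sum_range_succ]
    exact (hm.union_le _ _).trans (by gcongr)

open Classical in
/-- The countably additive part of a content, obtained from the outer measure that it generates by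
way of coverings by sets with the property of Baire. -/
theorem exists_measure (hm : IsMeagreNullContent m) {𝓣 : Set (Set K)}
    (hopen : ∀ U ∈ 𝓣, IsOpen U)
    (hseq : ∀ U : ℕ → Set K, (∀ m, IsOpen (U m)) → Monotone U → (⋃ m, U m) ∈ 𝓣 → ∃ m, U m ∈ 𝓣)
    (hcongr : ∀ U V : Set K, U ∈ 𝓣 → IsOpen V → IsMeagre (symmDiff U V) → V ∈ 𝓣)
    {k : ℝ} (hk : ∀ U ∈ 𝓣, k ≤ m U) :
    ∃ ν : @Measure K (eventuallyMeasurableSpace (borel K) (residual K)),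
      ν Set.univ ≤ 1 ∧ (∀ A, IsMeagre A → ν A = 0) ∧ ∀ U ∈ 𝓣, ENNReal.ofReal k ≤ ν U := by
  -- The value `⊤` excludes coverings by other sets, and makes the Carathéodory inequality trivial
  -- for test sets without the property of Baire.
  let μ : Set K → ENNReal := fun A => if BaireMeasurableSet A then ENNReal.ofReal (m A) else ⊤
  have hμ : ∀ A, BaireMeasurableSet A → μ A = ENNReal.ofReal (m A) := fun A hA => if_pos hA
  have hμ0 : μ ∅ = 0 := by
    rw [hμ _ IsMeagre.empty.baireMeasurableSet, hm.meagre _ IsMeagre.empty, ENNReal.ofReal_zero]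
  have hle : eventuallyMeasurableSpace (borel K) (residual K) ≤
      (OuterMeasure.ofFunction μ hμ0).caratheodory := by
    intro A hA
    have hA : BaireMeasurableSet A := hA
    refine OuterMeasure.ofFunction_caratheodory fun t => ?_
    by_cases ht : BaireMeasurableSet t
    · rw [hμ _ ht, hμ _ (ht.inter hA), hμ _ (ht.diff hA),
        ← ENNReal.ofReal_add (hm.nonneg _) (hm.nonneg _), hm.inter_add_diff]
    · simp [μ, ht]
  have hν : ∀ A, BaireMeasurableSet A →
      @OuterMeasure.toMeasure K (eventuallyMeasurableSpace (borel K) (residual K))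
        (OuterMeasure.ofFunction μ hμ0) hle A = OuterMeasure.ofFunction μ hμ0 A := fun A hA =>
    @toMeasure_apply K (eventuallyMeasurableSpace (borel K) (residual K)) _ hle A hA
  refine ⟨@OuterMeasure.toMeasure K (eventuallyMeasurableSpace (borel K) (residual K))
    (OuterMeasure.ofFunction μ hμ0) hle, ?_, fun A hA => ?_, fun U hU => ?_⟩
  · rw [hν _ isOpen_univ.baireMeasurableSet]
    refine (OuterMeasure.ofFunction_le _).trans ?_
    rw [hμ _ isOpen_univ.baireMeasurableSet, hm.univ, ENNReal.ofReal_one]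
  · rw [hν _ hA.baireMeasurableSet]
    refine le_antisymm ((OuterMeasure.ofFunction_le _).trans ?_) zero_le
    rw [hμ _ hA.baireMeasurableSet, hm.meagre _ hA, ENNReal.ofReal_zero]
  · rw [hν _ (hopen U hU).baireMeasurableSet, OuterMeasure.ofFunction_apply]
    refine le_iInf fun t => le_iInf fun ht => ?_
    by_cases hbaire : ∀ i, BaireMeasurableSet (t i)
    -- The covering is replaced, modulo meagre sets, by open subsets of `U`. Their union lies in `𝓣`
    -- by `hcongr`, hence so does a finite partial union by `hseq`; there finite subadditivity of
    -- `m` suffices.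
    · choose W hW htW using fun i => (hbaire i).residualEq_isOpen
      let V : ℕ → Set K := fun i => W i ∩ U
      have hV : ∀ i, IsOpen (V i) := fun i => (hW i).inter (hopen U hU)
      have hUV : U =ᶠ[residual K] ⋃ i, accumulate V i := by
        rw [iUnion_accumulate]
        have h1 : U = ⋃ i, t i ∩ U := by
          rw [← iUnion_inter, inter_eq_self_of_subset_right ht]
        conv_lhs => rw [h1]
        exact Filter.EventuallyEq.countable_iUnion fun i => (htW i).inter (EventuallyEq.refl _ _)
      have hacc : ∀ i, IsOpen (accumulate V i) := fun i =>
        isOpen_biUnion fun j _ => hV j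
      obtain ⟨n, hn⟩ := hseq _ hacc monotone_accumulate
        (hcongr U _ hU (isOpen_iUnion hacc) (isMeagre_symmDiff_iff.2 hUV))
      calc ENNReal.ofReal k ≤ ENNReal.ofReal (∑ i ∈ Finset.range (n + 1), m (t i)) := by
            refine ENNReal.ofReal_le_ofReal ((hk _ hn).trans ((hm.accumulate_le V n).trans ?_))
            refine Finset.sum_le_sum fun i _ => ?_
            rw [hm.congr (htW i)]
            exact hm.mono inter_subset_left
        _ = ∑ i ∈ Finset.range (n + 1), μ (t i) := by
            rw [ENNReal.ofReal_sum_of_nonneg fun i _ => hm.nonneg _]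
            exact Finset.sum_congr rfl fun i _ => (hμ _ (hbaire i)).symm
        _ ≤ ∑' i, μ (t i) := ENNReal.sum_le_tsum _
    · push Not at hbaire
      obtain ⟨i, hi⟩ := hbaire
      have h1 : μ (t i) = ⊤ := if_neg hi
      exact le_top.trans (h1.ge.trans (ENNReal.le_tsum i))

end IsMeagreNullContent

/-! ### Kelley's theorem by extension of positive functionals -/

variable (K) in
/-- The bounded real functions on a set. -/
def boundedFunctions : Submodule ℝ (K → ℝ) where
  carrier := {f | ∃ C, ∀ x, |f x| ≤ C}
  add_mem' := by
    rintro f g ⟨C, hC⟩ ⟨D, hD⟩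
    exact ⟨C + D, fun x => (abs_add_le _ _).trans (add_le_add (hC x) (hD x))⟩
  zero_mem' := ⟨0, by simp⟩
  smul_mem' := by
    rintro c f ⟨C, hC⟩
    refine ⟨|c| * C, fun x => ?_⟩
    rw [Pi.smul_apply, smul_eq_mul, abs_mul]
    exact mul_le_mul_of_nonneg_left (hC x) (abs_nonneg c)

/-- The indicator function of a set. -/
noncomputable def boundedIndicator (A : Set K) : boundedFunctions K :=
  ⟨A.indicator 1, 1, fun x => by by_cases hx : x ∈ A <;> simp [hx]⟩

/-- The cone of the functions that dominate, outside a meagre set, a positive combination of the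
functions `1_U - k` with `U` in a collection of sets. -/
def kelleyCone (𝓣 : Set (Set K)) (k : ℝ) : PointedCone ℝ (boundedFunctions K) where
  carrier := {h | ∃ (ι : Type) (_ : Fintype ι) (F : ι → Set K) (a : ι → ℝ), (∀ i, F i ∈ 𝓣) ∧
    (∀ i, 0 ≤ a i) ∧ ∀ᶠ x in residual K, ∑ i, a i * ((F i).indicator 1 x - k) ≤ h.1 x}
  add_mem' := by
    rintro f g ⟨ι, _, F, a, hF, ha, hf⟩ ⟨κ, _, G, b, hG, hb, hg⟩
    refine ⟨ι ⊕ κ, inferInstance, Sum.elim F G, Sum.elim a b, ?_, ?_, ?_⟩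
    · rintro (i | i)
      · exact hF i
      · exact hG i
    · rintro (i | i)
      · exact ha i
      · exact hb i
    · filter_upwards [hf, hg] with x hfx hgx
      rw [Fintype.sum_sum_type]
      exact add_le_add hfx hgx
  zero_mem' := ⟨Empty, inferInstance, Empty.elim, Empty.elim, by simp, by simp, by simp⟩
  smul_mem' := by
    rintro c f ⟨ι, _, F, a, hF, ha, hf⟩
    refine ⟨ι, inferInstance, F, fun i => c * a i, hF, fun i => mul_nonneg c.2 (ha i), ?_⟩
    filter_upwards [hf] with x hfx
    simp only [mul_assoc, ← Finset.mul_sum]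
    exact mul_le_mul_of_nonneg_left hfx c.2

theorem mem_kelleyCone_of_nonneg {𝓣 : Set (Set K)} {k : ℝ} {h : boundedFunctions K}
    (hh : ∀ᶠ x in residual K, 0 ≤ h.1 x) : h ∈ kelleyCone 𝓣 k :=
  ⟨Empty, inferInstance, Empty.elim, Empty.elim, by simp, by simp, by simpa using hh⟩

theorem boundedIndicator_sub_mem_kelleyCone {𝓣 : Set (Set K)} {k : ℝ} {U : Set K} (hU : U ∈ 𝓣) :
    boundedIndicator U - k • boundedIndicator univ ∈ kelleyCone 𝓣 k :=
  ⟨Unit, inferInstance, fun _ => U, fun _ => 1, fun _ => hU, fun _ => zero_le_one,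
    Eventually.of_forall fun x => by simp [boundedIndicator]⟩

variable [CompactSpace K] [T2Space K]

/-- The Kelley number provides, up to `ε`, a nonempty intersection of the sets on which the
combination of the `1_U - k` is nonnegative. This is the consistency condition for the extension
theorem. -/
theorem nonneg_of_smul_mem_kelleyCone [Nonempty K] {𝓣 : Set (Set K)}
    (hopen : ∀ U ∈ 𝓣, IsOpen U) {k : ℝ} (hk : ENNReal.ofReal k ≤ kelleyNumber 𝓣) (hk0 : 0 ≤ k) {c : ℝ}
    (hc : c • boundedIndicator univ ∈ kelleyCone 𝓣 k) : 0 ≤ c := by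
  obtain ⟨ι, _, F, a, hF, ha, hx⟩ := hc
  refine le_of_forall_pos_le_add fun ε hε => ?_
  obtain ⟨J, hJ, hJk⟩ := exists_sum_ge_of_le_kelleyNumber hk hk0 hF a ha hε
  have hJo : IsOpen (⋂ i ∈ J, F i) := isOpen_biInter_finset fun i _ => hopen _ (hF i)
  -- Openness of the sets matters here: the intersection is open, so it meets the comeagre set on
  -- which the domination holds.
  obtain ⟨x, hxJ, hx⟩ := (dense_of_mem_residual hx).inter_open_nonempty _ hJo hJ
  have h1 : ∑ i, a i * ((F i).indicator 1 x - k) ≤ c := by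
    simpa [boundedIndicator] using hx
  have h2 : ∑ i ∈ J, a i ≤ ∑ i, a i * (F i).indicator 1 x := by
    calc ∑ i ∈ J, a i = ∑ i ∈ J, a i * (F i).indicator 1 x :=
          Finset.sum_congr rfl fun i hi => by simp [mem_iInter₂.1 hxJ i hi]
      _ ≤ ∑ i, a i * (F i).indicator 1 x :=
          Finset.sum_le_sum_of_subset_of_nonneg (Finset.subset_univ J) fun i _ _ =>
            mul_nonneg (ha i) (indicator_nonneg (fun _ _ => zero_le_one) x)
  simp only [mul_sub, Finset.sum_sub_distrib, ← Finset.sum_mul] at h1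
  rw [mul_comm k] at hJk
  linarith

/-- **Kelley's theorem**: a collection of open sets with Kelley number at least `k` admits a
finitely additive probability measure with values at least `k` on the collection. -/
theorem exists_isMeagreNullContent [Nonempty K] {𝓣 : Set (Set K)}
    (hopen : ∀ U ∈ 𝓣, IsOpen U) {k : ℝ} (hk : ENNReal.ofReal k ≤ kelleyNumber 𝓣) (hk0 : 0 ≤ k) :
    ∃ m : Set K → ℝ, IsMeagreNullContent m ∧ ∀ U ∈ 𝓣, k ≤ m U := by
  have hne : boundedIndicator (univ : Set K) ≠ 0 := fun h => by
    have := congrFun (congrArg Subtype.val h) (Classical.arbitrary K)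
    simp [boundedIndicator] at this
  -- The functional `c • 1 ↦ c` on the constants extends to one nonnegative on the cone; every
  -- bounded function enters the cone after adding a large constant.
  obtain ⟨g, hg, hg0⟩ := riesz_extension (kelleyCone 𝓣 k)
    (LinearPMap.mkSpanSingleton (boundedIndicator univ) (1 : ℝ) hne) (by
      rintro ⟨x, hx⟩ hxk
      obtain ⟨c, rfl⟩ := Submodule.mem_span_singleton.1 hx
      have := nonneg_of_smul_mem_kelleyCone hopen hk hk0 hxk
      exact this.trans_eq ((LinearPMap.mkSpanSingleton'_apply _ _ _ c hx).trans
        (mul_one c)).symm) (by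
      rintro ⟨y, C, hC⟩
      refine ⟨⟨C • boundedIndicator univ, Submodule.mem_span_singleton.2 ⟨C, rfl⟩⟩,
        mem_kelleyCone_of_nonneg (Eventually.of_forall fun x => ?_)⟩
      have := (abs_le.1 (hC x)).1
      simp only [boundedIndicator, Submodule.coe_add, Submodule.coe_smul, Pi.add_apply,
        Pi.smul_apply, indicator_univ, Pi.one_apply, smul_eq_mul, mul_one]
      linarith)
  have hg1 : g (boundedIndicator univ) = 1 := by
    have := hg ⟨boundedIndicator univ, Submodule.mem_span_singleton_self _⟩
    rw [this]
    exact LinearPMap.mkSpanSingleton_apply ℝ ℝ hne 1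
  refine ⟨fun A => g (boundedIndicator A), ⟨fun A => ?_, fun A B hAB => ?_, fun A hA => ?_, hg1⟩,
    fun U hU => ?_⟩
  · exact hg0 _ (mem_kelleyCone_of_nonneg (Eventually.of_forall fun x =>
      indicator_nonneg (fun _ _ => zero_le_one) x))
  · rw [← map_add]
    congr 1
    exact Subtype.ext (indicator_union_of_disjoint hAB 1)
  -- The cone ignores meagre sets, so it contains both the indicator of `A` and its negative.
  · have h0 : ∀ᶠ x in residual K, (boundedIndicator A).1 x = 0 := by
      filter_upwards [hA] with x hx
      exact indicator_of_notMem hx 1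
    refine le_antisymm ?_ (hg0 _ (mem_kelleyCone_of_nonneg (h0.mono fun x hx => hx.ge)))
    rw [← neg_nonneg, ← map_neg]
    refine hg0 _ (mem_kelleyCone_of_nonneg (h0.mono fun x hx => ?_))
    simp [hx]
  · have := hg0 _ (boundedIndicator_sub_mem_kelleyCone hU)
    rw [map_sub, map_smul, hg1, smul_eq_mul, mul_one] at this
    linarith

/-- Each class has a measure of mass at most one that is positive on its members and zero on meagre
sets. The weights `2⁻ⁿ` keep the sum finite, and every nonempty open set belongs to some class. -/
theorem exists_isCategoryMeasure_of_propertyTripleStar (h : PropertyTripleStar K) :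
    ∃ μ : @Measure K (eventuallyMeasurableSpace (borel K) (residual K)), IsCategoryMeasure μ := by
  rcases isEmpty_or_nonempty K with _ | _
  · refine ⟨0, by simp, fun A _ => ?_⟩
    rw [eq_empty_of_isEmpty A]
    simpa using IsMeagre.empty
  obtain ⟨T, -, hT, hTn⟩ := h
  have hTo : ∀ n, ∀ U ∈ T n, IsOpen U := fun n U hU => by
    have : U ∈ ⋃ n, T n := mem_iUnion.2 ⟨n, hU⟩
    rw [hT] at this
    exact this.1
  have key : ∀ n, ∃ ν : @Measure K (eventuallyMeasurableSpace (borel K) (residual K)),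
      ν univ ≤ 1 ∧ (∀ A, IsMeagre A → ν A = 0) ∧ ∀ U ∈ T n, ν U ≠ 0 := fun n => by
    -- The Kelley number may be infinite, for an empty class, so a finite positive bound below it is
    -- used.
    obtain ⟨k, hk0, hk⟩ := ENNReal.lt_iff_exists_nnreal_btwn.1 (hTn n).1
    have hk' : ENNReal.ofReal k = k := ENNReal.ofReal_coe_nnreal
    obtain ⟨m, hm, hmk⟩ := exists_isMeagreNullContent (hTo n) (k := k) (hk'.trans_le hk.le) k.2
    obtain ⟨ν, h1, h2, h3⟩ := hm.exists_measure (hTo n) (hTn n).2.1 (hTn n).2.2 hmk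
    exact ⟨ν, h1, h2, fun U hU => (hk0.trans_le (hk'.ge.trans (h3 U hU))).ne'⟩
  choose ν hν1 hν0 hνT using key
  let _ : MeasurableSpace K := eventuallyMeasurableSpace (borel K) (residual K)
  let μ : Measure K := Measure.sum fun n => (2⁻¹ : ENNReal) ^ n • ν n
  have hμ : ∀ A, BaireMeasurableSet A → μ A = ∑' n, (2⁻¹ : ENNReal) ^ n * ν n A := fun A hA => by
    rw [Measure.sum_apply _ hA]
    simp
  refine ⟨μ, ?_, fun A hA => ?_⟩
  · rw [hμ _ isOpen_univ.baireMeasurableSet]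
    calc ∑' n, (2⁻¹ : ENNReal) ^ n * ν n univ ≤ ∑' n, (2⁻¹ : ENNReal) ^ n :=
          ENNReal.tsum_le_tsum fun n => mul_le_of_le_one_right' (hν1 n)
      _ = 2 := ENNReal.tsum_geometric_two
      _ < ⊤ := by norm_num
  · rw [hμ _ hA, ENNReal.tsum_eq_zero]
    constructor
    · intro h
      obtain ⟨U, hU, hAU⟩ := hA.residualEq_isOpen
      rcases U.eq_empty_or_nonempty with rfl | hne
      · exact eventuallyEq_empty.1 hAU
      have hUT : U ∈ ⋃ n, T n := by
        rw [hT]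
        exact ⟨hU, hne⟩
      obtain ⟨n, hn⟩ := mem_iUnion.1 hUT
      refine (hνT n U hn ?_).elim
      have h1 : ν n A = 0 := by
        refine (mul_eq_zero.1 (h n)).resolve_left (pow_ne_zero _ (by norm_num))
      have h2 : ν n (symmDiff A U) = 0 := hν0 n _ (isMeagre_symmDiff_iff.2 hAU)
      rw [← measure_congr (measure_symmDiff_eq_zero_iff.1 h2), h1]
    · intro hA n
      rw [hν0 n A hA, mul_zero]

end FinitelyAdditive

/-! ### The equivalences -/

theorem mainTheorem7 (K : Type*) [TopologicalSpace K] [CompactSpace K] [T2Space K] :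
    List.TFAE [
      PropertyTripleStar K,
      ∃ μ : @MeasureTheory.Measure K (eventuallyMeasurableSpace (borel K) (residual K)),
        IsCategoryMeasure μ,
      ∃ φ : DedekindCompletion C(K, ℝ) →ₗ[ℝ] ℝ,
        IsStrictlyPositiveFunctional φ ∧ IsSigmaOrderContinuous φ,
      ∃ φ : C(K, ℝ) →ₗ[ℝ] ℝ, IsStrictlyPositiveFunctional φ ∧ IsSigmaOrderContinuous φ,
      ∃ φ : C(K, ℝ) →ₗ[ℝ] ℝ, IsStrictlyPositiveFunctional φ ∧ IsOrderContinuous φ,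
      ∃ φ : DedekindCompletion C(K, ℝ) →ₗ[ℝ] ℝ,
        IsStrictlyPositiveFunctional φ ∧ IsOrderContinuous φ] := by
  tfae_have 1 → 2 := exists_isCategoryMeasure_of_propertyTripleStar
  tfae_have 2 → 1 := fun ⟨μ, hμ⟩ => propertyTripleStar_of_isCategoryMeasure hμ
  tfae_have 2 → 4 := fun ⟨μ, hμ⟩ => exists_sigmaOrderContinuous_of_isCategoryMeasure hμ
  tfae_have 4 → 5 := fun ⟨φ, hφ, h⟩ => ⟨φ, hφ, hφ.isOrderContinuous h⟩
  tfae_have 5 → 2 := fun ⟨φ, hφ, h⟩ => exists_isCategoryMeasure_of_isOrderContinuous hφ h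
  tfae_have 5 → 6 := fun ⟨φ, hφ, h⟩ =>
    ⟨_, DedekindCompletion.isStrictlyPositiveFunctional_extendₗ hφ h,
      DedekindCompletion.isOrderContinuous_extendₗ hφ h⟩
  tfae_have 6 → 3 := fun ⟨φ, hφ, h⟩ => ⟨φ, hφ, h.isSigmaOrderContinuous⟩
  tfae_have 3 → 4 := fun ⟨φ, hφ, h⟩ =>
    ⟨_, DedekindCompletion.isStrictlyPositiveFunctional_comp_embedding hφ,
      DedekindCompletion.isSigmaOrderContinuous_comp_embedding hφ h⟩
  tfae_finish
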